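/- Let $\Bbbk$ be a field with $\operatorname{char}\Bbbk\neq 2$, let $n$ be a positive integer, and let $V=\Bbbk^n$ with standard basis $v_1,\dots,v_n$ be the permutation representation of $S_n$ (so $\sigma\cdot v_i=v_{\sigma(i)}$), restricted to the alternating group $A_n$; $V^{\otimes k}$ carries the diagonal action. Let $\mathcal{JP}(n)$ be the $\Bbbk$-linear strict monoidal category whose objects are the non-negative integers (with $a\otimes b=a+b$), generated by the object $1$ and the morphisms $\mu:2\to1$, $\eta:0\to1$, $\Delta:1\to2$, $\varepsilon:1\to0$, $s:2\to2$, $j:n\to0$, subject only to the relations $$s^2=1_2,\quad (1_1\otimes s)(s\otimes1_1)(1_1\otimes s)=(s\otimes1_1)(1_1\otimes s)(s\otimes1_1),$$ $$s(1_1\otimes\eta)=\eta\otimes1_1,\quad (1_1\otimes\mu)(s\otimes1_1)(1_1\otimes s)=s(\mu\otimes1_1),$$ $$(1_1\otimes\varepsilon)s=\varepsilon\otimes1_1,\quad (1_1\otimes s)(s\otimes1_1)(1_1\otimes\Delta)=(\Delta\otimes1_1)s,$$ $$\mu(1_1\otimes\eta)=1_1,\quad (1_1\otimes\varepsilon)\Delta=1_1=(\varepsilon\otimes1_1)\Delta,$$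 $$(\mu\otimes1_1)(1_1\otimes\Delta)=\Delta\mu=(1_1\otimes\mu)(\Delta\otimes1_1),\quad \mu s=\mu,\quad \mu\Delta=1_1,\quad \varepsilon\eta=n,$$ $$j\otimes1_1=(1_1\otimes j)\,s_1\cdots s_n,\qquad j\,s_i=-j\ (1\le i<n),\qquad j\otimes j=\sum_{\sigma\in S_n}(-1)^\sigma\, c_n\,(\sigma\otimes1_n).$$ Here $s_i=1_{i-1}\otimes s\otimes 1_{m-i-1}:m\to m$ is the crossing of the $i$-th and $(i+1)$-st of $m$ strands, a permutation $\sigma$ is regarded as a morphism through any expression of it as a product of the $s_i$, and $c_n:2n\to0$ is the diagram that joins the $i$-th point to the $(n+i)$-th point, for $1\le i\le n$, by caps $\varepsilon\mu$. A jellyfish diagram is a morphism of $\mathcal{JP}(n)$ that is obtained from identities, the five partition generators $\mu,\eta,\Delta,\varepsilon,s$ and $j$ by composition and tensor product. Let $\Psi:\mathcal{JP}(n)\to\operatorname{Rep}(A_n)$ be the $\Bbbk$-linear monoidal functor with $\Psi(k)=V^{\otimes k}$ (the monoidal structure being given by the canonical isomorphisms $\Bbbk\cong V^{\otimes0}$ and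 $V^{\otimes a}\otimes V^{\otimes b}\cong V^{\otimes(a+b)}$) and $$\Psi(\mu)(v_x\otimes v_y)=\delta_{x,y}v_x,\quad \Psi(\eta)(1)=\sum_{x=1}^n v_x,\quad \Psi(\Delta)(v_x)=v_x\otimes v_x,\quad \Psi(\varepsilon)(v_x)=1,$$ $$\Psi(s)(u\otimes w)=w\otimes u,\qquad \Psi(j)(u_1\otimes\cdots\otimes u_n)=\det[u_1\ \cdots\ u_n].$$ **Theorem.** This monoidal functor $\Psi$ is well defined and it is full. Consequently, for all $k,\ell\ge0$, every $A_n$-equivariant linear map $V^{\otimes k}\to V^{\otimes\ell}$ is the image under $\Psi$ of a $\Bbbk$-linear combination of jellyfish diagrams. -/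

import Mathlib

open CategoryTheory MonoidalCategory
open scoped TensorProduct

universe u

noncomputable section

namespace Jellyfish

/-! ## The category `JP(n)`, by generators and relations -/

/-- Formal expressions for morphisms of a `k`-linear strict monoidal category whose objects are the
natural numbers (`a ⊗ b = a + b`), in the generators `μ, η, Δ, ε, s` and `j : n → 0`.
The expression `comp f g` means "first `f`, then `g`", i.e. `g ∘ f`. -/
inductive Term (k : Type u) (n : ℕ) : ℕ → ℕ → Type u
  | one (a : ℕ) : Term k n a a
  | comp {a b c : ℕ} (f : Term k n a b) (g : Term k n b c) : Term k n a c
  | tens {a b c d : ℕ} (f : Term k n a b) (g : Term k n c d) : Term k n (a + c) (b + d)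
  | zero (a b : ℕ) : Term k n a b
  | add {a b : ℕ} (f g : Term k n a b) : Term k n a b
  | smul {a b : ℕ} (r : k) (f : Term k n a b) : Term k n a b
  | mu : Term k n 2 1
  | eta : Term k n 0 1
  | delta : Term k n 1 2
  | eps : Term k n 1 0
  | swap : Term k n 2 2
  | jelly : Term k n n 0

namespace Term

variable {k : Type u} {n : ℕ}

/-- Transport of an expression along equalities of its source and target. -/
def cast {a b a' b' : ℕ} (ha : a = a') (hb : b = b') (t : Term k n a b) : Term k n a' b' :=
  ha ▸ hb ▸ t

/-- The crossing of the strands `i + 1` and `i + 2` among `m` strands (the strands being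
numbered from `1`), that is, `s_{i+1}^{(m)} = 1_i ⊗ s ⊗ 1_{m-i-2}`. -/
def swapAt {m : ℕ} (i : Fin (m - 1)) : Term k n m m :=
  cast (by have := i.2; omega) (by have := i.2; omega)
    (tens (tens (one i.1) swap) (one (m - (i.1 + 2))))

/-- The permutation diagram `s_{i₁} ∘ ⋯ ∘ s_{iᵣ}` of a word `[i₁, …, iᵣ]` (the last letter acts
first). -/
def permWord {m : ℕ} : List (Fin (m - 1)) → Term k n m m
  | [] => one m
  | i :: w => comp (permWord w) (swapAt i)

/-- The cap `ε ∘ μ : 2 → 0`. -/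
def cap : Term k n 2 0 := comp mu eps

/-- The diagram `m + m → 0` that joins the `i`-th bottom vertex to the `(m + i)`-th, for
`1 ≤ i ≤ m`: the `(m + 1)`-st strand is moved to the right past the next `m` strands and is then
capped with the last strand, and one continues with the remaining `m + m` strands. -/
def crosscap : (m : ℕ) → Term k n (m + m) 0
  | 0 => one 0
  | m + 1 =>
    comp
      (cast (by omega) (by omega)
        (tens (one m) (tens (permWord (m := m + 1) (List.finRange m).reverse) (one 1))) :
          Term k n ((m + 1) + (m + 1)) ((m + m) + 2))
      (tens (crosscap m) cap)

/-- The sum of a list of expressions. -/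
def listSum {a b : ℕ} (l : List (Term k n a b)) : Term k n a b := l.foldr add (zero a b)

end Term

/-- The adjacent transposition of the (zero-based) points `i` and `i + 1`. -/
def adjTransposition {m : ℕ} (i : Fin (m - 1)) : Equiv.Perm (Fin m) :=
  Equiv.swap ⟨i.1, by have := i.2; omega⟩ ⟨i.1 + 1, by have := i.2; omega⟩

/-- The permutation represented by a word in the adjacent transpositions. -/
def wordPerm {m : ℕ} (w : List (Fin (m - 1))) : Equiv.Perm (Fin m) :=
  (w.map adjTransposition).prod

/-- Every permutation is represented by a word in the adjacent transpositions. -/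
theorem exists_wordPerm {m : ℕ} (σ : Equiv.Perm (Fin m)) :
    ∃ w : List (Fin (m - 1)), wordPerm w = σ := by
  cases m with
  | zero => exact ⟨[], Subsingleton.elim _ _⟩
  | succ m =>
    have h : σ ∈ Submonoid.closure
        (Set.range fun i : Fin m => Equiv.swap i.castSucc i.succ) := by
      rw [Equiv.Perm.mclosure_swap_castSucc_succ]; trivial
    induction h using Submonoid.closure_induction_left with
    | one => exact ⟨[], rfl⟩
    | mul_left x hx y _ ih =>
      obtain ⟨i, rfl⟩ := hx
      obtain ⟨w, hw⟩ := ih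
      exact ⟨i :: w, by rw [← hw]; rfl⟩

open Term in
/-- Equality of morphisms in `JP(n)`: the smallest congruence on formal expressions that contains
the axioms of a `k`-linear strict monoidal category and the defining relations. -/
inductive Rel {k : Type u} [Field k] {n : ℕ} : {a b : ℕ} → Term k n a b → Term k n a b → Prop
  -- congruence
  | refl {a b} (f : Term k n a b) : Rel f f
  | symm {a b} {f g : Term k n a b} : Rel f g → Rel g f
  | trans {a b} {f g h : Term k n a b} : Rel f g → Rel g h → Rel f h
  | comp_congr {a b c} {f f' : Term k n a b} {g g' : Term k n b c} :
      Rel f f' → Rel g g' → Rel (comp f g) (comp f' g')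
  | tensor_congr {a b c d} {f f' : Term k n a b} {g g' : Term k n c d} :
      Rel f f' → Rel g g' → Rel (tens f g) (tens f' g')
  | add_congr {a b} {f f' g g' : Term k n a b} :
      Rel f f' → Rel g g' → Rel (add f g) (add f' g')
  | smul_congr {a b} (r : k) {f f' : Term k n a b} : Rel f f' → Rel (smul r f) (smul r f')
  -- category
  | id_comp {a b} (f : Term k n a b) : Rel (comp (one a) f) f
  | comp_id {a b} (f : Term k n a b) : Rel (comp f (one b)) f
  | assoc {a b c d} (f : Term k n a b) (g : Term k n b c) (h : Term k n c d) :
      Rel (comp (comp f g) h) (comp f (comp g h))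
  -- vector spaces of morphisms
  | add_assoc {a b} (f g h : Term k n a b) : Rel (add (add f g) h) (add f (add g h))
  | add_comm {a b} (f g : Term k n a b) : Rel (add f g) (add g f)
  | zero_add {a b} (f : Term k n a b) : Rel (add (zero a b) f) f
  | smul_add {a b} (r : k) (f g : Term k n a b) :
      Rel (smul r (add f g)) (add (smul r f) (smul r g))
  | add_smul {a b} (r s : k) (f : Term k n a b) :
      Rel (smul (r + s) f) (add (smul r f) (smul s f))
  | mul_smul {a b} (r s : k) (f : Term k n a b) : Rel (smul (r * s) f) (smul r (smul s f))
  | one_smul {a b} (f : Term k n a b) : Rel (smul 1 f) f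
  | zero_smul {a b} (f : Term k n a b) : Rel (smul 0 f) (zero a b)
  -- bilinearity of composition and tensor product
  | add_comp {a b c} (f f' : Term k n a b) (g : Term k n b c) :
      Rel (comp (add f f') g) (add (comp f g) (comp f' g))
  | comp_add {a b c} (f : Term k n a b) (g g' : Term k n b c) :
      Rel (comp f (add g g')) (add (comp f g) (comp f g'))
  | smul_comp {a b c} (r : k) (f : Term k n a b) (g : Term k n b c) :
      Rel (comp (smul r f) g) (smul r (comp f g))
  | comp_smul {a b c} (r : k) (f : Term k n a b) (g : Term k n b c) :
      Rel (comp f (smul r g)) (smul r (comp f g))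
  | add_tensor {a b c d} (f f' : Term k n a b) (g : Term k n c d) :
      Rel (tens (add f f') g) (add (tens f g) (tens f' g))
  | tensor_add {a b c d} (f : Term k n a b) (g g' : Term k n c d) :
      Rel (tens f (add g g')) (add (tens f g) (tens f g'))
  | smul_tensor {a b c d} (r : k) (f : Term k n a b) (g : Term k n c d) :
      Rel (tens (smul r f) g) (smul r (tens f g))
  | tensor_smul {a b c d} (r : k) (f : Term k n a b) (g : Term k n c d) :
      Rel (tens f (smul r g)) (smul r (tens f g))
  -- strict monoidal category
  | tensor_id (a b : ℕ) : Rel (tens (one a) (one b)) (one (a + b))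
  | interchange {a b c a' b' c'} (f : Term k n a b) (g : Term k n b c)
      (f' : Term k n a' b') (g' : Term k n b' c') :
      Rel (tens (comp f g) (comp f' g')) (comp (tens f f') (tens g g'))
  | tensor_assoc {a b c d e f} (x : Term k n a b) (y : Term k n c d) (z : Term k n e f) :
      Rel (cast (Nat.add_assoc a c e) (Nat.add_assoc b d f) (tens (tens x y) z))
        (tens x (tens y z))
  | tensor_unit {a b} (f : Term k n a b) : Rel (tens f (one 0)) f
  | unit_tensor {a b} (f : Term k n a b) :
      Rel (cast (Nat.zero_add a) (Nat.zero_add b) (tens (one 0) f)) f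
  -- relations of the partition category
  | swap_swap : Rel (comp swap swap) (one 2)
  | braid : Rel (comp (tens (one 1) swap :) (comp (tens swap (one 1) :) (tens (one 1) swap :)))
      (comp (tens swap (one 1) :) (comp (tens (one 1) swap :) (tens swap (one 1) :)))
  | eta_swap : Rel (comp (tens (one 1) eta :) swap) (tens eta (one 1) :)
  | mu_swap : Rel
      (comp (tens (one 1) swap :) (comp (tens swap (one 1) :) (tens (one 1) mu :)))
      (comp (tens mu (one 1) :) swap)
  | eps_swap : Rel (comp swap (tens (one 1) eps :)) (tens eps (one 1) :)
  | delta_swap : Rel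
      (comp (tens (one 1) delta :) (comp (tens swap (one 1) :) (tens (one 1) swap :)))
      (comp swap (tens delta (one 1) :))
  | unit : Rel (comp (tens (one 1) eta :) mu) (one 1)
  | counit_right : Rel (comp delta (tens (one 1) eps :)) (one 1)
  | counit_left : Rel (comp delta (tens eps (one 1) :)) (one 1)
  | frobenius_left : Rel (comp (tens (one 1) delta :) (tens mu (one 1) :)) (comp mu delta)
  | frobenius_right : Rel (comp (tens delta (one 1) :) (tens (one 1) mu :)) (comp mu delta)
  | commutative : Rel (comp swap mu) mu
  | special : Rel (comp delta mu) (one 1)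
  | dimension : Rel (comp eta eps) (smul (n : k) (one 0))
  -- relations of the jellyfish
  | jelly_swim : Rel (tens jelly (one 1))
      (comp (permWord (m := n + 1) (List.finRange n))
        (cast (Nat.add_comm 1 n) (Nat.add_comm 1 0) (tens (one 1) jelly)))
  | jelly_skew (i : Fin (n - 1)) : Rel (comp (swapAt i) jelly) (smul (-1) jelly)
  | jelly_jelly (w : Equiv.Perm (Fin n) → List (Fin (n - 1))) (hw : ∀ σ, wordPerm (w σ) = σ) :
      Rel (tens jelly jelly)
        (listSum ((Finset.univ : Finset (Equiv.Perm (Fin n))).toList.map fun σ =>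
          smul ((Equiv.Perm.sign σ : ℤ) : k)
            (comp (tens (permWord (w σ)) (one n)) (crosscap n))))

section Category

variable {k : Type u} [Field k] {n : ℕ}

/-- The setoid of equality of morphisms in `JP(n)`. -/
instance termSetoid (a b : ℕ) : Setoid (Term k n a b) where
  r := Rel
  iseqv := ⟨Rel.refl, Rel.symm, Rel.trans⟩

variable (k n) in
/-- The morphisms `a → b` of `JP(n)`. -/
def HomSet (a b : ℕ) : Type u := Quotient (termSetoid (k := k) (n := n) a b)

/-- The morphism given by a formal expression. -/
def homMk {a b : ℕ} (t : Term k n a b) : HomSet k n a b := Quotient.mk _ t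

theorem homMk_eq {a b : ℕ} {t t' : Term k n a b} (h : Rel t t') : homMk t = homMk t' :=
  Quotient.sound h

/-- The jellyfish partition category `JP(n)` over `k`; its objects are the natural numbers. -/
structure JP (k : Type u) (n : ℕ) where
  /-- the number of strands -/
  strands : ℕ

instance : Category.{u} (JP k n) where
  Hom X Y := HomSet k n X.strands Y.strands
  id X := homMk (Term.one _)
  comp f g := Quotient.map₂ Term.comp (fun _ _ h _ _ h' => Rel.comp_congr h h') f g
  id_comp f := by
    induction f using Quotient.inductionOn; exact homMk_eq (Rel.id_comp _)
  comp_id f := by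
    induction f using Quotient.inductionOn; exact homMk_eq (Rel.comp_id _)
  assoc f g h := by
    induction f using Quotient.inductionOn
    induction g using Quotient.inductionOn
    induction h using Quotient.inductionOn
    exact homMk_eq (Rel.assoc _ _ _)

namespace JP

/-- The morphism of `JP(n)` given by a formal expression. -/
def ofTerm {X Y : JP k n} (t : Term k n X.strands Y.strands) : X ⟶ Y := homMk t

theorem ofTerm_eq {X Y : JP k n} {t t' : Term k n X.strands Y.strands} (h : Rel t t') :
    (ofTerm t : X ⟶ Y) = ofTerm t' := homMk_eq h

theorem ofTerm_surjective {X Y : JP k n} (f : X ⟶ Y) : ∃ t, ofTerm t = f := Quotient.exists_rep f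

theorem id_def (X : JP k n) : 𝟙 X = ofTerm (Term.one _) := rfl

theorem comp_mk {X Y Z : JP k n} (f : Term k n X.strands Y.strands)
    (g : Term k n Y.strands Z.strands) : (ofTerm f : X ⟶ Y) ≫ (ofTerm g : Y ⟶ Z) = ofTerm (f.comp g) := rfl

theorem ofTerm_cast {X Y X' Y' : JP k n} (t : Term k n X.strands Y.strands) (hX : X = X') (hY : Y = Y') :
    (ofTerm (Term.cast (congrArg strands hX) (congrArg strands hY) t) : X' ⟶ Y') =
      eqToHom hX.symm ≫ ofTerm t ≫ eqToHom hY := by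
  subst hX hY
  simp [Term.cast]

instance (X Y : JP k n) : Add (X ⟶ Y) :=
  ⟨fun f g => Quotient.map₂ Term.add (fun _ _ h _ _ h' => Rel.add_congr h h') f g⟩

instance (X Y : JP k n) : Zero (X ⟶ Y) := ⟨ofTerm (Term.zero _ _)⟩

instance (X Y : JP k n) : Neg (X ⟶ Y) :=
  ⟨fun f => Quotient.map (Term.smul (-1)) (fun _ _ h => Rel.smul_congr _ h) f⟩

instance homAddCommGroup (X Y : JP k n) : AddCommGroup (X ⟶ Y) where
  nsmul := nsmulRec
  zsmul := zsmulRec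
  add_assoc f g h := by
    induction f using Quotient.inductionOn
    induction g using Quotient.inductionOn
    induction h using Quotient.inductionOn
    exact homMk_eq (Rel.add_assoc _ _ _)
  add_comm f g := by
    induction f using Quotient.inductionOn
    induction g using Quotient.inductionOn
    exact homMk_eq (Rel.add_comm _ _)
  zero_add f := by
    induction f using Quotient.inductionOn; exact homMk_eq (Rel.zero_add _)
  add_zero f := by
    induction f using Quotient.inductionOn
    exact homMk_eq ((Rel.add_comm _ _).trans (Rel.zero_add _))
  neg_add_cancel f := by
    induction f using Quotient.inductionOn with | _ f =>
    refine homMk_eq (Rel.trans (Rel.add_congr (Rel.refl _) (Rel.one_smul f).symm) ?_)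
    refine Rel.trans (Rel.add_smul _ _ _).symm ?_
    rw [neg_add_cancel]
    exact Rel.zero_smul f

theorem add_mk {X Y : JP k n} (f g : Term k n X.strands Y.strands) :
    (ofTerm f : X ⟶ Y) + ofTerm g = ofTerm (f.add g) := rfl

instance homModule (X Y : JP k n) : Module k (X ⟶ Y) where
  smul r f := Quotient.map (Term.smul r) (fun _ _ h => Rel.smul_congr _ h) f
  one_smul f := by
    induction f using Quotient.inductionOn; exact homMk_eq (Rel.one_smul _)
  mul_smul r s f := by
    induction f using Quotient.inductionOn; exact homMk_eq (Rel.mul_smul _ _ _)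
  smul_zero r := by
    refine homMk_eq ?_
    refine Rel.trans (Rel.smul_congr r (Rel.zero_smul (Term.zero _ _)).symm) ?_
    refine Rel.trans (Rel.mul_smul _ _ _).symm ?_
    rw [mul_zero]
    exact Rel.zero_smul _
  smul_add r f g := by
    induction f using Quotient.inductionOn
    induction g using Quotient.inductionOn
    exact homMk_eq (Rel.smul_add _ _ _)
  add_smul r s f := by
    induction f using Quotient.inductionOn; exact homMk_eq (Rel.add_smul _ _ _)
  zero_smul f := by
    induction f using Quotient.inductionOn; exact homMk_eq (Rel.zero_smul _)

theorem smul_mk {X Y : JP k n} (r : k) (f : Term k n X.strands Y.strands) :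
    r • (ofTerm f : X ⟶ Y) = ofTerm (f.smul r) := rfl

instance : Preadditive (JP k n) where
  add_comp _ _ _ f f' g := by
    induction f using Quotient.inductionOn
    induction f' using Quotient.inductionOn
    induction g using Quotient.inductionOn
    exact homMk_eq (Rel.add_comp _ _ _)
  comp_add _ _ _ f g g' := by
    induction f using Quotient.inductionOn
    induction g using Quotient.inductionOn
    induction g' using Quotient.inductionOn
    exact homMk_eq (Rel.comp_add _ _ _)

instance : Linear k (JP k n) where
  smul_comp _ _ _ r f g := by
    induction f using Quotient.inductionOn
    induction g using Quotient.inductionOn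
    exact homMk_eq (Rel.smul_comp _ _ _)
  comp_smul _ _ _ f r g := by
    induction f using Quotient.inductionOn
    induction g using Quotient.inductionOn
    exact homMk_eq (Rel.comp_smul _ _ _)

/-- The tensor product of morphisms of `JP(n)` (horizontal stacking). -/
def tensorMor {X Y X' Y' : JP k n} (f : X ⟶ Y) (g : X' ⟶ Y') :
    (⟨X.strands + X'.strands⟩ : JP k n) ⟶ (⟨Y.strands + Y'.strands⟩ : JP k n) :=
  Quotient.map₂ Term.tens (fun _ _ h _ _ h' => Rel.tensor_congr h h') f g

theorem tensorMor_eqToHom {X Y X' Y' : JP k n} (h : X = Y) (h' : X' = Y') :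
    tensorMor (eqToHom h) (eqToHom h') = eqToHom (by rw [h, h']) := by
  subst h h'
  exact homMk_eq (Rel.tensor_id _ _)

instance : MonoidalCategoryStruct (JP k n) where
  tensorObj X Y := ⟨X.strands + Y.strands⟩
  tensorUnit := ⟨0⟩
  tensorHom f g := tensorMor f g
  whiskerLeft X _ _ f := tensorMor (𝟙 X) f
  whiskerRight f Y := tensorMor f (𝟙 Y)
  associator X Y Z := eqToIso (congrArg JP.mk (Nat.add_assoc X.strands Y.strands Z.strands))
  leftUnitor X := eqToIso (congrArg JP.mk (Nat.zero_add X.strands))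
  rightUnitor X := eqToIso (congrArg JP.mk (Nat.add_zero X.strands))

theorem tensorHom_ofTerm {X Y X' Y' : JP k n} (f : Term k n X.strands Y.strands)
    (g : Term k n X'.strands Y'.strands) :
    (ofTerm f : X ⟶ Y) ⊗ₘ (ofTerm g : X' ⟶ Y') = ofTerm (X := X ⊗ X') (Y := Y ⊗ Y') (f.tens g) := rfl

theorem associator_hom (X Y Z : JP k n) :
    (α_ X Y Z).hom = eqToHom (congrArg JP.mk (Nat.add_assoc _ _ _)) := rfl

theorem leftUnitor_hom (X : JP k n) :
    (λ_ X).hom = eqToHom (congrArg JP.mk (Nat.zero_add _)) := rfl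

theorem rightUnitor_hom (X : JP k n) :
    (ρ_ X).hom = eqToHom (congrArg JP.mk (Nat.add_zero _)) := rfl

theorem tensorHom_eqToHom {X Y X' Y' : JP k n} (h : X = Y) (h' : X' = Y') :
    eqToHom h ⊗ₘ eqToHom h' = eqToHom (by rw [h, h']) := tensorMor_eqToHom h h'

instance : MonoidalCategory (JP k n) :=
  MonoidalCategory.ofTensorHom
    (id_tensorHom_id := fun X Y => homMk_eq (Rel.tensor_id _ _))
    (id_tensorHom := fun _ _ _ _ => rfl)
    (tensorHom_id := fun _ _ => rfl)
    (tensorHom_comp_tensorHom := fun f₁ f₂ g₁ g₂ => by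
      obtain ⟨f₁, rfl⟩ := ofTerm_surjective f₁
      obtain ⟨f₂, rfl⟩ := ofTerm_surjective f₂
      obtain ⟨g₁, rfl⟩ := ofTerm_surjective g₁
      obtain ⟨g₂, rfl⟩ := ofTerm_surjective g₂
      exact (homMk_eq (Rel.interchange _ _ _ _)).symm)
    (associator_naturality := fun {X₁ X₂ X₃ Y₁ Y₂ Y₃} f₁ f₂ f₃ => by
      obtain ⟨f₁, rfl⟩ := ofTerm_surjective f₁
      obtain ⟨f₂, rfl⟩ := ofTerm_surjective f₂
      obtain ⟨f₃, rfl⟩ := ofTerm_surjective f₃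
      have h := ofTerm_cast (X := (X₁ ⊗ X₂) ⊗ X₃) (Y := (Y₁ ⊗ Y₂) ⊗ Y₃) (X' := X₁ ⊗ X₂ ⊗ X₃)
        (Y' := Y₁ ⊗ Y₂ ⊗ Y₃) ((f₁.tens f₂).tens f₃)
        (congrArg JP.mk (Nat.add_assoc _ _ _)) (congrArg JP.mk (Nat.add_assoc _ _ _))
      have h' := (ofTerm_eq (X := X₁ ⊗ X₂ ⊗ X₃) (Y := Y₁ ⊗ Y₂ ⊗ Y₃)
        (Rel.tensor_assoc f₁ f₂ f₃)).symm.trans h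
      simp only [tensorHom_ofTerm]
      rw [associator_hom, associator_hom]
      refine Eq.trans ?_ (congrArg (eqToHom _ ≫ ·) h').symm
      simp only [eqToHom_trans_assoc, eqToHom_refl, Category.id_comp])
    (leftUnitor_naturality := fun {X Y} f => by
      obtain ⟨f, rfl⟩ := ofTerm_surjective f
      have h := ofTerm_cast (X := 𝟙_ _ ⊗ X) (Y := 𝟙_ _ ⊗ Y) (X' := X) (Y' := Y)
        ((Term.one 0).tens f)
        (congrArg JP.mk (Nat.zero_add _)) (congrArg JP.mk (Nat.zero_add _))
      have h' := (ofTerm_eq (X := X) (Y := Y) (Rel.unit_tensor f)).symm.trans h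
      rw [leftUnitor_hom, leftUnitor_hom]
      refine Eq.trans ?_ (congrArg (eqToHom _ ≫ ·) h').symm
      simp only [eqToHom_trans_assoc, eqToHom_refl, Category.id_comp]
      rfl)
    (rightUnitor_naturality := fun {X Y} f => by
      obtain ⟨f, rfl⟩ := ofTerm_surjective f
      change _ ≫ 𝟙 _ = 𝟙 _ ≫ _
      simp only [Category.comp_id, Category.id_comp]
      exact homMk_eq (Rel.tensor_unit f))
    (pentagon := fun W X Y Z => by
      simp only [associator_hom, ← eqToHom_refl _ rfl, tensorHom_eqToHom, eqToHom_trans])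
    (triangle := fun X Y => by
      simp only [associator_hom, leftUnitor_hom, rightUnitor_hom, ← eqToHom_refl _ rfl,
        tensorHom_eqToHom, eqToHom_trans])

instance : MonoidalPreadditive (JP k n) where
  whiskerLeft_zero := by
    intro X Y Z
    change tensorMor _ _ = _
    rw [← zero_smul k (0 : Y ⟶ Z)]
    refine (homMk_eq (Rel.tensor_smul 0 _ _)).trans ?_
    exact homMk_eq (Rel.zero_smul _)
  zero_whiskerRight := by
    intro X Y Z
    change tensorMor _ _ = _
    rw [← zero_smul k (0 : Y ⟶ Z)]
    refine (homMk_eq (Rel.smul_tensor 0 _ _)).trans ?_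
    exact homMk_eq (Rel.zero_smul _)
  whiskerLeft_add f g := by
    obtain ⟨f, rfl⟩ := ofTerm_surjective f
    obtain ⟨g, rfl⟩ := ofTerm_surjective g
    exact homMk_eq (Rel.tensor_add _ _ _)
  add_whiskerRight f g := by
    obtain ⟨f, rfl⟩ := ofTerm_surjective f
    obtain ⟨g, rfl⟩ := ofTerm_surjective g
    exact homMk_eq (Rel.add_tensor _ _ _)

instance : MonoidalLinear k (JP k n) where
  whiskerLeft_smul _ _ _ r f := by
    obtain ⟨f, rfl⟩ := ofTerm_surjective f
    exact homMk_eq (Rel.tensor_smul _ _ _)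
  smul_whiskerRight r _ _ f _ := by
    obtain ⟨f, rfl⟩ := ofTerm_surjective f
    exact homMk_eq (Rel.smul_tensor _ _ _)

end JP
end Category

/-! ## Tensor powers of the permutation representation -/

section TensorPowers

variable (k : Type u) [Field k] (n : ℕ)

/-- The permutation representation `V = k^n` of `S_n`, with `σ · v_i = v_{σ(i)}`. -/
def permRep : Representation k (Equiv.Perm (Fin n)) (Fin n → k) where
  toFun σ := LinearMap.funLeft k k (σ⁻¹ : Equiv.Perm (Fin n))
  map_one' := by ext; simp [LinearMap.funLeft]
  map_mul' σ τ := by ext; simp [LinearMap.funLeft]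

/-- The tensor power `V^{⊗a}` of `V = k^n`. -/
abbrev TP (a : ℕ) : Type u := ⨂[k]^a (Fin n → k)

/-- The diagonal action of `S_n` on `V^{⊗a}`. -/
def tensorRep (a : ℕ) : Representation k (Equiv.Perm (Fin n)) (TP k n a) where
  toFun σ := PiTensorProduct.map fun _ => permRep k n σ
  map_one' := by simp only [map_one]; exact PiTensorProduct.map_one
  map_mul' σ τ := by simp only [map_mul]; exact PiTensorProduct.map_mul _ _

/-- The diagonal action of `A_n` on `V^{⊗a}`. -/
def altTensorRep (a : ℕ) : Representation k (alternatingGroup (Fin n)) (TP k n a) :=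
  (tensorRep k n a).comp (alternatingGroup (Fin n)).subtype

variable {k n}

/-- The basis vector `v_i = v_{i_1} ⊗ ⋯ ⊗ v_{i_a}` of `V^{⊗a}`. -/
def vec {a : ℕ} (i : Fin a → Fin n) : TP k n a :=
  PiTensorProduct.tprod k fun r => Pi.single (i r) 1

variable (k n) in
/-- The basis of `V^{⊗a}` that consists of the vectors `v_i`. -/
def vecBasis (a : ℕ) : Module.Basis (Fin a → Fin n) k (TP k n a) :=
  Basis.piTensorProduct fun _ => Pi.basisFun k (Fin n)

theorem vecBasis_apply {a : ℕ} (i : Fin a → Fin n) : vecBasis k n a i = vec i := by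
  simp [vecBasis, vec]

/-- The linear map with prescribed values on the basis vectors `v_i`. -/
def onVec {a b : ℕ} (f : (Fin a → Fin n) → TP k n b) : TP k n a →ₗ[k] TP k n b :=
  (vecBasis k n a).constr k f

theorem onVec_vec {a b : ℕ} (f : (Fin a → Fin n) → TP k n b) (i : Fin a → Fin n) :
    onVec f (vec i) = f i := by
  rw [← vecBasis_apply, onVec, Module.Basis.constr_basis]

theorem ext_vec {a : ℕ} {M : Type*} [AddCommMonoid M] [Module k M] {f g : TP k n a →ₗ[k] M}
    (h : ∀ i, f (vec i) = g (vec i)) : f = g :=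
  (vecBasis k n a).ext fun i => by rw [vecBasis_apply, h]

/-- The product `V^{⊗a} × V^{⊗b} → V^{⊗(a+b)}`. -/
def tmul {a b : ℕ} (x : TP k n a) (y : TP k n b) : TP k n (a + b) :=
  TensorPower.mulEquiv (x ⊗ₜ[k] y)

/-- The tensor product of two linear maps between tensor powers of `V`. -/
def tmulMap {a b c d : ℕ} (f : TP k n a →ₗ[k] TP k n b) (g : TP k n c →ₗ[k] TP k n d) :
    TP k n (a + c) →ₗ[k] TP k n (b + d) :=
  (TensorPower.mulEquiv (R := k) (M := Fin n → k) (n := b) (m := d)).toLinearMap ∘ₗ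
    TensorProduct.map f g ∘ₗ
    (TensorPower.mulEquiv (R := k) (M := Fin n → k) (n := a) (m := c)).symm.toLinearMap

theorem tmulMap_tmul {a b c d : ℕ} (f : TP k n a →ₗ[k] TP k n b) (g : TP k n c →ₗ[k] TP k n d)
    (x : TP k n a) (y : TP k n c) : tmulMap f g (tmul x y) = tmul (f x) (g y) := by
  simp [tmulMap, tmul]

theorem tmul_tprod {a b : ℕ} (v : Fin a → Fin n → k) (w : Fin b → Fin n → k) :
    tmul (PiTensorProduct.tprod k v) (PiTensorProduct.tprod k w) =
      PiTensorProduct.tprod k (Fin.append v w) :=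
  TensorPower.tprod_mul_tprod k v w

theorem tmul_vec {a b : ℕ} (i : Fin a → Fin n) (j : Fin b → Fin n) :
    tmul (vec i) (vec j) = (vec (Fin.append i j) : TP k n (a + b)) := by
  refine (tmul_tprod _ _).trans (congrArg _ (funext fun r => ?_))
  refine Fin.addCases (fun r => ?_) (fun r => ?_) r <;> simp

theorem ext_tmul {a b : ℕ} {M : Type*} [AddCommMonoid M] [Module k M]
    {f g : TP k n (a + b) →ₗ[k] M} (h : ∀ x y, f (tmul x y) = g (tmul x y)) : f = g := by
  have : f ∘ₗ (TensorPower.mulEquiv (R := k) (M := Fin n → k) (n := a) (m := b)).toLinearMap =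
      g ∘ₗ (TensorPower.mulEquiv (R := k) (M := Fin n → k) (n := a) (m := b)).toLinearMap :=
    TensorProduct.ext' h
  ext1
  refine MultilinearMap.ext fun v => ?_
  have h' := congrArg (fun F => F (TensorPower.mulEquiv.symm (PiTensorProduct.tprod k v))) this
  simpa using h'

theorem ext_append {a b : ℕ} {M : Type*} [AddCommMonoid M] [Module k M]
    {f g : TP k n (a + b) →ₗ[k] M}
    (h : ∀ (i : Fin a → Fin n) (j : Fin b → Fin n),
      f (vec (Fin.append i j)) = g (vec (Fin.append i j))) : f = g :=
  ext_vec fun i => by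
    rw [← Fin.append_castAdd_natAdd (f := i)]; exact h _ _

theorem tmulMap_vec {a b c d : ℕ} (f : TP k n a →ₗ[k] TP k n b) (g : TP k n c →ₗ[k] TP k n d)
    (i : Fin a → Fin n) (j : Fin c → Fin n) :
    tmulMap f g (vec (Fin.append i j)) = tmul (f (vec i)) (g (vec j)) := by
  rw [← tmul_vec, tmulMap_tmul]

theorem tmul_add {a b : ℕ} (x : TP k n a) (y y' : TP k n b) :
    tmul x (y + y') = tmul x y + tmul x y' := by simp [tmul, TensorProduct.tmul_add]

theorem add_tmul {a b : ℕ} (x x' : TP k n a) (y : TP k n b) :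
    tmul (x + x') y = tmul x y + tmul x' y := by simp [tmul, TensorProduct.add_tmul]

theorem tmul_smul {a b : ℕ} (r : k) (x : TP k n a) (y : TP k n b) :
    tmul x (r • y) = r • tmul x y := by simp [tmul]

theorem smul_tmul {a b : ℕ} (r : k) (x : TP k n a) (y : TP k n b) :
    tmul (r • x) y = r • tmul x y := by
  rw [tmul, ← TensorProduct.smul_tmul', map_smul]; rfl

theorem tmul_sum {a b : ℕ} {ι : Type*} (s : Finset ι) (x : TP k n a) (y : ι → TP k n b) :
    tmul x (∑ r ∈ s, y r) = ∑ r ∈ s, tmul x (y r) := by simp [tmul, TensorProduct.tmul_sum]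

theorem sum_tmul {a b : ℕ} {ι : Type*} (s : Finset ι) (x : ι → TP k n a) (y : TP k n b) :
    tmul (∑ r ∈ s, x r) y = ∑ r ∈ s, tmul (x r) y := by simp [tmul, TensorProduct.sum_tmul]

theorem zero_tmul {a b : ℕ} (y : TP k n b) : tmul (0 : TP k n a) y = 0 := by
  simpa using smul_tmul (0 : k) (0 : TP k n a) y

theorem tmul_zero {a b : ℕ} (x : TP k n a) : tmul x (0 : TP k n b) = 0 := by
  simpa using tmul_smul (0 : k) x (0 : TP k n b)

variable (k n) in
/-- The identification of equal tensor powers. -/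
def tcast {a b : ℕ} (h : a = b) : TP k n a ≃ₗ[k] TP k n b := TensorPower.cast k (Fin n → k) h

theorem tcast_rfl {a : ℕ} (h : a = a) (x : TP k n a) : tcast k n h x = x := by
  simp [tcast]

theorem tcast_vec {a b : ℕ} (h : a = b) (i : Fin a → Fin n) :
    tcast k n h (vec i) = vec (i ∘ Fin.cast h.symm) :=
  TensorPower.cast_tprod k _ h _

theorem tcast_tmul_assoc {a b c : ℕ} (x : TP k n a) (y : TP k n b) (z : TP k n c) :
    tcast k n (Nat.add_assoc a b c) (tmul (tmul x y) z) = tmul x (tmul y z) :=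
  TensorPower.mul_assoc x y z

theorem tcast_tmul_left {a : ℕ} (x : TP k n a) :
    tcast k n (Nat.zero_add a) (tmul (vec ![]) x) = x := by
  have h : (vec ![] : TP k n 0) = GradedMonoid.GOne.one (A := fun i => TP k n i) :=
    congrArg (PiTensorProduct.tprod k) (Subsingleton.elim _ _)
  rw [h]
  exact TensorPower.one_mul x

theorem tmul_right {a : ℕ} (x : TP k n a) : tmul x (vec ![] : TP k n 0) = x := by
  have h : (vec ![] : TP k n 0) = GradedMonoid.GOne.one (A := fun i => TP k n i) :=
    congrArg (PiTensorProduct.tprod k) (Subsingleton.elim _ _)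
  rw [h]
  exact (tcast_rfl rfl _).symm.trans (TensorPower.mul_one x)

theorem vec_zero (i : Fin 0 → Fin n) : (vec i : TP k n 0) = vec ![] :=
  congrArg vec (Subsingleton.elim _ _)

/-! ## The images of the generators -/

/-- `v_x ⊗ v_y ↦ δ_{x,y} v_x`. -/
def muMap : TP k n 2 →ₗ[k] TP k n 1 := onVec fun i => if i 0 = i 1 then vec ![i 0] else 0

/-- `1 ↦ ∑ v_x`. -/
def etaMap : TP k n 0 →ₗ[k] TP k n 1 := onVec fun _ => ∑ x : Fin n, vec ![x]

/-- `v_x ↦ v_x ⊗ v_x`. -/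
def deltaMap : TP k n 1 →ₗ[k] TP k n 2 := onVec fun i => vec ![i 0, i 0]

/-- `v_x ↦ 1`. -/
def epsMap : TP k n 1 →ₗ[k] TP k n 0 := onVec fun _ => vec ![]

/-- `v_x ⊗ v_y ↦ v_y ⊗ v_x`. -/
def swapMap : TP k n 2 →ₗ[k] TP k n 2 := onVec fun i => vec ![i 1, i 0]

/-- `v_{i_1} ⊗ ⋯ ⊗ v_{i_n} ↦ det [v_{i_1} ⋯ v_{i_n}]`, the matrix with columns `v_{i_c}`. -/
def detMap : TP k n n →ₗ[k] TP k n 0 :=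
  onVec fun i => Matrix.det (Matrix.of fun r c => (Pi.single (i c) 1 : Fin n → k) r) • vec ![]

/-- The linear map given by a formal expression. -/
def eval : {a b : ℕ} → Term k n a b → (TP k n a →ₗ[k] TP k n b)
  | _, _, .one _ => LinearMap.id
  | _, _, .comp f g => eval g ∘ₗ eval f
  | _, _, .tens f g => tmulMap (eval f) (eval g)
  | _, _, .zero _ _ => 0
  | _, _, .add f g => eval f + eval g
  | _, _, .smul r f => r • eval f
  | _, _, .mu => muMap
  | _, _, .eta => etaMap
  | _, _, .delta => deltaMap
  | _, _, .eps => epsMap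
  | _, _, .swap => swapMap
  | _, _, .jelly => detMap

theorem eval_cast {a b a' b' : ℕ} (ha : a = a') (hb : b = b') (t : Term k n a b) :
    eval (t.cast ha hb) =
      (tcast k n hb).toLinearMap ∘ₗ eval t ∘ₗ (tcast k n ha.symm).toLinearMap := by
  subst ha hb
  ext1; simp [Term.cast, tcast]

end TensorPowers
section Words

/-! ## The linear map of an expression depends only on the morphism -/

theorem adjTransposition_inv {m : ℕ} (i : Fin (m - 1)) :
    (adjTransposition i)⁻¹ = adjTransposition i := Equiv.swap_inv _ _

theorem wordPerm_cons {m : ℕ} (i : Fin (m - 1)) (w : List (Fin (m - 1))) :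
    wordPerm (i :: w) = adjTransposition i * wordPerm w := by simp [wordPerm]

theorem wordPerm_reverse {m : ℕ} (w : List (Fin (m - 1))) :
    wordPerm w.reverse = (wordPerm w)⁻¹ := by
  rw [wordPerm, wordPerm, List.prod_inv_reverse, List.map_reverse, List.map_map]
  congr 2

theorem wordPerm_finRange (m : ℕ) (r : Fin (m + 1)) :
    (wordPerm (m := m + 1) (List.finRange m) r).val = if r.val < m then r.val + 1 else 0 := by
  have key : ∀ j ≤ m, ∀ r : Fin (m + 1),
      (wordPerm (m := m + 1) ((List.finRange m).take j) r).val =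
        if r.val < j then r.val + 1 else if r.val = j then 0 else r.val := by
    intro j
    induction j with
    | zero =>
      intro _ r
      simp [wordPerm]
    | succ j ih =>
      intro hj r
      have h1 : (List.finRange m).take (j + 1) = (List.finRange m).take j ++ [⟨j, hj⟩] := by
        rw [List.take_succ_eq_append_getElem (by simpa using hj)]
        simp
      have h2 : wordPerm (m := m + 1) ((List.finRange m).take (j + 1)) =
          wordPerm (m := m + 1) ((List.finRange m).take j) *
            adjTransposition (m := m + 1) ⟨j, hj⟩ := by
        rw [h1]; simp [wordPerm]
      rw [h2, Equiv.Perm.mul_apply, ih (by omega)]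
      simp only [adjTransposition, Equiv.swap_apply_def, Fin.ext_iff]
      split_ifs <;> simp_all <;> omega
  have h := key m le_rfl r
  rw [List.take_of_length_le (by simp)] at h
  rw [h]
  have := r.2
  split_ifs <;> first | rfl | omega

theorem append_eq {α : Type*} {a b : ℕ} (u : Fin a → α) (v : Fin b → α) (r : Fin (a + b)) :
    Fin.append u v r = if h : r.val < a then u ⟨r.val, h⟩ else
      v ⟨r.val - a, by have := r.2; omega⟩ := by
  refine Fin.addCases (fun r => ?_) (fun r => ?_) r <;> simp

theorem append_single_inj {α : Type*} {m : ℕ} {u v : Fin m → α} {a b : α} :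
    Fin.append u ![a] = Fin.append v ![b] ↔ u = v ∧ a = b := by
  constructor
  · intro h
    refine ⟨funext fun r => ?_, ?_⟩
    · simpa using congrFun h (Fin.castAdd 1 r)
    · simpa using congrFun h (Fin.natAdd m 0)
  · rintro ⟨rfl, rfl⟩
    rfl

end Words

section Relations

variable {k : Type u} [Field k] {n : ℕ}

theorem swap_core {p q : ℕ} (x : Fin (p + 2 + q) → Fin n) :
    tmulMap (tmulMap LinearMap.id swapMap) LinearMap.id (vec x : TP k n (p + 2 + q)) =
      vec (x ∘ Equiv.swap ⟨p, by omega⟩ ⟨p + 1, by omega⟩) := by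
  obtain ⟨y, v, rfl⟩ : ∃ (y : Fin (p + 2) → Fin n) (v : Fin q → Fin n), x = Fin.append y v :=
    ⟨_, _, Fin.append_castAdd_natAdd.symm⟩
  obtain ⟨u, w, rfl⟩ : ∃ (u : Fin p → Fin n) (w : Fin 2 → Fin n), y = Fin.append u w :=
    ⟨_, _, Fin.append_castAdd_natAdd.symm⟩
  rw [tmulMap_vec, tmulMap_vec, swapMap, onVec_vec]
  simp only [LinearMap.id_apply]
  rw [tmul_vec, tmul_vec]
  congr 1
  funext r
  have := r.2
  simp only [append_eq, Function.comp_apply, Equiv.swap_apply_def, Fin.ext_iff]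
  rcases lt_trichotomy r.val p with h | h | h
  · have h1 : r.val ≠ p := by omega
    have h2 : r.val ≠ p + 1 := by omega
    have h3 : r.val < p + 2 := by omega
    simp [h, h1, h2, h3]
  · simp [h]
  · by_cases h2 : r.val = p + 1
    · simp [h2]
    · have h1 : r.val ≠ p := by omega
      have h3 : ¬ r.val < p + 2 := by omega
      simp [h1, h2, h3]

theorem eval_swapAt {m : ℕ} (i : Fin (m - 1)) (x : Fin m → Fin n) :
    eval (Term.swapAt i : Term k n m m) (vec x) = vec (x ∘ adjTransposition i) := by
  rw [Term.swapAt, eval_cast]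
  simp only [LinearMap.comp_apply, LinearEquiv.coe_coe, tcast_vec, eval]
  rw [swap_core, tcast_vec]
  congr 1
  funext r
  simp only [Function.comp_apply]
  congr 1
  simp only [adjTransposition, Equiv.swap_apply_def, Fin.ext_iff, Fin.val_cast]
  split_ifs <;> rfl

theorem eval_permWord {m : ℕ} (w : List (Fin (m - 1))) (x : Fin m → Fin n) :
    eval (Term.permWord w : Term k n m m) (vec x) = vec (x ∘ ((wordPerm w)⁻¹ : Equiv.Perm _)) := by
  induction w with
  | nil => rfl
  | cons i w ih =>
    rw [Term.permWord, eval, LinearMap.comp_apply, ih, eval_swapAt, wordPerm_cons, mul_inv_rev,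
      adjTransposition_inv]
    rfl

theorem rotate_append {m : ℕ} (u : Fin m → Fin n) (a : Fin n) :
    (Fin.append ![a] u ∘ Fin.cast (Nat.add_comm m 1)) ∘
      wordPerm (m := m + 1) (List.finRange m) = Fin.append u ![a] := by
  funext r
  have h := wordPerm_finRange m r
  simp only [Function.comp_apply, append_eq, Fin.val_cast]
  by_cases hr : r.val < m
  · rw [if_pos hr] at h
    simp [h, hr]
  · rw [if_neg hr] at h
    simp [h, hr]

theorem eval_rotate {m : ℕ} (u : Fin m → Fin n) (a : Fin n) :
    eval (Term.permWord (m := m + 1) (List.finRange m) : Term k n (m + 1) (m + 1))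
      (vec (Fin.append u ![a])) =
      vec (Fin.append ![a] u ∘ Fin.cast (Nat.add_comm m 1)) := by
  rw [eval_permWord, ← rotate_append]
  congr 1
  funext r
  simp

theorem eval_rotate' {m : ℕ} (u : Fin m → Fin n) (a : Fin n) :
    eval (Term.permWord (m := m + 1) (List.finRange m).reverse : Term k n (m + 1) (m + 1))
      (vec (Fin.append ![a] u ∘ Fin.cast (Nat.add_comm m 1))) = vec (Fin.append u ![a]) := by
  rw [eval_permWord, wordPerm_reverse, inv_inv, rotate_append]

theorem eval_cap (a b : Fin n) :
    eval (Term.cap : Term k n 2 0) (vec ![a, b]) = (if a = b then 1 else 0 : k) • vec ![] := by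
  simp only [Term.cap, eval, LinearMap.comp_apply, muMap, onVec_vec]
  by_cases h : a = b
  · simp [h, epsMap, onVec_vec]
  · simp [h]

theorem eval_crosscap {m : ℕ} (x y : Fin m → Fin n) :
    eval (Term.crosscap m : Term k n (m + m) 0) (vec (Fin.append x y)) =
      (if x = y then 1 else 0 : k) • vec ![] := by
  induction m with
  | zero =>
    rw [if_pos (Subsingleton.elim _ _), one_smul]
    exact vec_zero _
  | succ m ih =>
    obtain ⟨x, a, rfl⟩ : ∃ (x' : Fin m → Fin n) (a : Fin n), x = Fin.append x' ![a] :=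
      ⟨fun i => x i.castSucc, x (Fin.last m), by
        funext r; refine Fin.lastCases ?_ (fun r => ?_) r
        · simp [Fin.append, Fin.addCases]
        · simp [Fin.append, Fin.addCases]⟩
    obtain ⟨y, b, rfl⟩ : ∃ (y' : Fin m → Fin n) (b : Fin n), y = Fin.append y' ![b] :=
      ⟨fun i => y i.castSucc, y (Fin.last m), by
        funext r; refine Fin.lastCases ?_ (fun r => ?_) r
        · simp [Fin.append, Fin.addCases]
        · simp [Fin.append, Fin.addCases]⟩
    have e1 : Fin.append (Fin.append x ![a]) (Fin.append y ![b]) ∘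
        Fin.cast (by omega : m + ((m + 1) + 1) = (m + 1) + (m + 1)) =
        Fin.append x (Fin.append (Fin.append ![a] y ∘ Fin.cast (Nat.add_comm m 1)) ![b]) := by
      funext r
      have := r.2
      simp only [Function.comp_apply, append_eq, Fin.val_cast]
      by_cases h1 : r.val < m
      · have h2 : r.val < m + 1 := by omega
        simp [h1, h2]
      · by_cases h2 : r.val < m + 1
        · have h3 : r.val = m := by omega
          simp [h3]
        · by_cases h4 : r.val < m + (m + 1)
          · have h5 : r.val - (m + 1) < m := by omega
            have h6 : r.val - m < m + 1 := by omega
            have h7 : ¬ r.val - m < 1 := by omega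
            have h8 : r.val - (m + 1) = r.val - m - 1 := by omega
            simp [h1, h2, h6, h7, h8, h8 ▸ h5]
          · have h5 : ¬ r.val - (m + 1) < m := by omega
            have h6 : ¬ r.val - m < m + 1 := by omega
            simp [h1, h2, h5, h6]
    have e2 : Fin.append x (Fin.append (Fin.append y ![a]) ![b]) ∘
        Fin.cast (by omega : (m + m) + 2 = m + ((m + 1) + 1)) =
        Fin.append (Fin.append x y) ![a, b] := by
      funext r
      have := r.2
      simp only [Function.comp_apply, append_eq, Fin.val_cast]
      by_cases h1 : r.val < m
      · have h2 : r.val < m + m := by omega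
        simp [h1, h2]
      · by_cases h2 : r.val < m + m
        · have h3 : r.val - m < m := by omega
          have h4 : r.val - m < m + 1 := by omega
          simp [h1, h2, h3, h4]
        · by_cases h3 : r.val = m + m
          · simp [h3]
          · have h4 : r.val = m + m + 1 := by omega
            have h5 : m + m + 1 - m = m + 1 := by omega
            have h6 : ¬ (m + m + 1 < m) := by omega
            simp [h4, h5, h6]
    rw [Term.crosscap, eval, eval_cast]
    simp only [LinearMap.comp_apply, LinearEquiv.coe_coe, tcast_vec, eval]
    rw [e1, tmulMap_vec, tmulMap_vec, eval_rotate']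
    simp only [LinearMap.id_apply]
    rw [tmul_vec, tmul_vec, tcast_vec, e2, tmulMap_vec, ih, eval_cap, smul_tmul, tmul_smul,
      smul_smul]
    have e4 : (tmul (vec ![] : TP k n 0) (vec ![] : TP k n 0) : TP k n (0 + 0)) = vec ![] :=
      tmul_right _
    rw [e4]
    congr 1
    simp only [append_single_inj]
    split_ifs <;> simp_all
end Relations
section Sound

variable {k : Type u} [Field k] {n : ℕ}

theorem tmul_vec12 (x y z : Fin n) :
    (vec ![x, y, z] : TP k n 3) = (tmul (vec ![x]) (vec ![y, z]) : TP k n (1 + 2)) := by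
  rw [tmul_vec]
  refine congrArg vec (funext fun r => ?_)
  fin_cases r <;> rfl

theorem tmul_vec21 (x y z : Fin n) :
    (vec ![x, y, z] : TP k n 3) = (tmul (vec ![x, y]) (vec ![z]) : TP k n (2 + 1)) := by
  rw [tmul_vec]
  refine congrArg vec (funext fun r => ?_)
  fin_cases r <;> rfl

theorem tmul_vec11 (x y : Fin n) :
    (vec ![x, y] : TP k n 2) = (tmul (vec ![x]) (vec ![y]) : TP k n (1 + 1)) := by
  rw [tmul_vec]
  refine congrArg vec (funext fun r => ?_)
  fin_cases r <;> rfl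

theorem tmul_vec10 (x : Fin n) :
    (vec ![x] : TP k n 1) = (tmul (vec ![x]) (vec ![]) : TP k n (1 + 0)) := (tmul_right _).symm

theorem tmul_vec01 (x : Fin n) :
    (vec ![x] : TP k n 1) = (tmul (vec ![]) (vec ![x]) : TP k n (0 + 1)) := by
  rw [tmul_vec]
  refine congrArg vec (funext fun r => ?_)
  fin_cases r; rfl

theorem ext1_vec {M : Type*} [AddCommMonoid M] [Module k M] {f g : TP k n 1 →ₗ[k] M}
    (h : ∀ x, f (vec ![x]) = g (vec ![x])) : f = g :=
  ext_vec fun i => by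
    have : i = ![i 0] := by funext r; fin_cases r; rfl
    rw [this]; exact h _

theorem ext2_vec {M : Type*} [AddCommMonoid M] [Module k M] {f g : TP k n 2 →ₗ[k] M}
    (h : ∀ x y, f (vec ![x, y]) = g (vec ![x, y])) : f = g :=
  ext_vec fun i => by
    have : i = ![i 0, i 1] := by funext r; fin_cases r <;> rfl
    rw [this]; exact h _ _

theorem ext3_vec {M : Type*} [AddCommMonoid M] [Module k M] {f g : TP k n 3 →ₗ[k] M}
    (h : ∀ x y z, f (vec ![x, y, z]) = g (vec ![x, y, z])) : f = g :=
  ext_vec fun i => by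
    have : i = ![i 0, i 1, i 2] := by funext r; fin_cases r <;> rfl
    rw [this]; exact h _ _ _

theorem swapMap_vec (x y : Fin n) : swapMap (vec ![x, y] : TP k n 2) = vec ![y, x] :=
  onVec_vec _ _

theorem muMap_vec (x y : Fin n) :
    muMap (vec ![x, y] : TP k n 2) = if x = y then vec ![x] else 0 := onVec_vec _ _

theorem etaMap_vec : etaMap (vec ![] : TP k n 0) = ∑ x, vec ![x] := onVec_vec _ _

theorem deltaMap_vec (x : Fin n) : deltaMap (vec ![x] : TP k n 1) = vec ![x, x] := onVec_vec _ _

theorem epsMap_vec (x : Fin n) : epsMap (vec ![x] : TP k n 1) = vec ![] := onVec_vec _ _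

theorem detMap_vec (i : Fin n → Fin n) : detMap (vec i : TP k n n) =
    Matrix.det (Matrix.of fun r c => (Pi.single (i c) 1 : Fin n → k) r) • vec ![] := onVec_vec _ _

theorem id_swap (x y z : Fin n) :
    eval (Term.tens (.one 1) .swap : Term k n (1 + 2) (1 + 2)) (vec ![x, y, z] : TP k n 3) =
      (vec ![x, z, y] : TP k n 3) := by
  rw [tmul_vec12, tmul_vec12, eval]
  refine (tmulMap_tmul _ _ _ _).trans ?_
  rw [eval, eval, swapMap_vec]; rfl

theorem swap_id (x y z : Fin n) :
    eval (Term.tens .swap (.one 1) : Term k n (2 + 1) (2 + 1)) (vec ![x, y, z] : TP k n 3) =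
      (vec ![y, x, z] : TP k n 3) := by
  rw [tmul_vec21, tmul_vec21, eval]
  refine (tmulMap_tmul _ _ _ _).trans ?_
  rw [eval, eval, swapMap_vec]; rfl

theorem id_mu (x y z : Fin n) :
    eval (Term.tens (.one 1) .mu : Term k n (1 + 2) (1 + 1)) (vec ![x, y, z] : TP k n 3) =
      if y = z then (vec ![x, y] : TP k n 2) else 0 := by
  rw [tmul_vec12]
  refine (tmulMap_tmul _ _ _ _).trans ?_
  rw [eval, eval, muMap_vec]
  split_ifs
  · exact (tmul_vec11 _ _).symm
  · exact tmul_zero _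

theorem mu_id (x y z : Fin n) :
    eval (Term.tens .mu (.one 1) : Term k n (2 + 1) (1 + 1)) (vec ![x, y, z] : TP k n 3) =
      if x = y then (vec ![x, z] : TP k n 2) else 0 := by
  rw [tmul_vec21]
  refine (tmulMap_tmul _ _ _ _).trans ?_
  rw [eval, eval, muMap_vec]
  split_ifs
  · exact (tmul_vec11 _ _).symm
  · exact zero_tmul _

theorem id_eta (x : Fin n) :
    eval (Term.tens (.one 1) .eta : Term k n (1 + 0) (1 + 1)) (vec ![x] : TP k n 1) =
      ∑ y, (vec ![x, y] : TP k n 2) := by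
  rw [tmul_vec10, eval]
  refine (tmulMap_tmul _ _ _ _).trans ?_
  rw [eval, eval, etaMap_vec]
  exact (tmul_sum _ _ _).trans (Finset.sum_congr rfl fun y _ => (tmul_vec11 x y).symm)

theorem eta_id (x : Fin n) :
    eval (Term.tens .eta (.one 1) : Term k n (0 + 1) (1 + 1)) (vec ![x] : TP k n 1) =
      ∑ y, (vec ![y, x] : TP k n 2) := by
  rw [tmul_vec01, eval]
  refine (tmulMap_tmul _ _ _ _).trans ?_
  rw [eval, eval, etaMap_vec]
  exact (sum_tmul _ _ _).trans (Finset.sum_congr rfl fun y _ => (tmul_vec11 y x).symm)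

theorem id_delta (x y : Fin n) :
    eval (Term.tens (.one 1) .delta : Term k n (1 + 1) (1 + 2)) (vec ![x, y] : TP k n 2) =
      (vec ![x, y, y] : TP k n 3) := by
  rw [tmul_vec12, tmul_vec11, eval]
  refine (tmulMap_tmul _ _ _ _).trans ?_
  rw [eval, eval, deltaMap_vec]; rfl

theorem delta_id (x y : Fin n) :
    eval (Term.tens .delta (.one 1) : Term k n (1 + 1) (2 + 1)) (vec ![x, y] : TP k n 2) =
      (vec ![x, x, y] : TP k n 3) := by
  rw [tmul_vec21, tmul_vec11, eval]
  refine (tmulMap_tmul _ _ _ _).trans ?_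
  rw [eval, eval, deltaMap_vec]; rfl

theorem id_eps (x y : Fin n) :
    eval (Term.tens (.one 1) .eps : Term k n (1 + 1) (1 + 0)) (vec ![x, y] : TP k n 2) =
      (vec ![x] : TP k n 1) := by
  rw [tmul_vec11]
  refine (tmulMap_tmul _ _ _ _).trans ?_
  rw [eval, eval, epsMap_vec]
  exact (tmul_vec10 _).symm

theorem eps_id (x y : Fin n) :
    eval (Term.tens .eps (.one 1) : Term k n (1 + 1) (0 + 1)) (vec ![x, y] : TP k n 2) =
      (vec ![y] : TP k n 1) := by
  rw [tmul_vec11]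
  refine (tmulMap_tmul _ _ _ _).trans ?_
  rw [eval, eval, epsMap_vec]
  exact (tmul_vec01 _).symm

theorem eval_listSum {a b : ℕ} (l : List (Term k n a b)) :
    eval (Term.listSum l) = (l.map eval).sum := by
  induction l with
  | nil => rfl
  | cons t l ih =>
    rw [List.map_cons, List.sum_cons, ← ih]
    rfl

theorem eval_jelly_swim : eval (Term.tens .jelly (.one 1) : Term k n (n + 1) (0 + 1)) =
    eval (.comp (Term.permWord (m := n + 1) (List.finRange n))
      (Term.cast (Nat.add_comm 1 n) (Nat.add_comm 1 0) (.tens (.one 1) .jelly))) := by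
  refine ext_append fun u w => ?_
  obtain ⟨a, rfl⟩ : ∃ a, w = ![a] := ⟨w 0, by funext r; fin_cases r; rfl⟩
  refine (tmulMap_vec _ _ _ _).trans ?_
  rw [eval.eq_2, LinearMap.comp_apply, eval_rotate, eval_cast]
  simp only [LinearMap.comp_apply, LinearEquiv.coe_coe, tcast_vec, eval]
  have h : (Fin.append ![a] u ∘ Fin.cast (Nat.add_comm n 1)) ∘ Fin.cast (Nat.add_comm 1 n) =
      Fin.append ![a] u := rfl
  rw [h, tmulMap_vec, detMap_vec, smul_tmul, tmul_smul, map_smul]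
  congr 1
  exact (tmul_vec01 a).symm.trans ((tmul_vec10 a).trans (tcast_rfl rfl _).symm)

theorem eval_jelly_skew (i : Fin (n - 1)) :
    eval (.comp (Term.swapAt i) .jelly : Term k n n 0) = eval (.smul (-1) .jelly) := by
  refine ext_vec fun x => ?_
  rw [eval, LinearMap.comp_apply, eval_swapAt]
  simp only [eval, LinearMap.smul_apply]
  rw [detMap_vec, detMap_vec, smul_smul]
  congr 1
  have h := Matrix.det_permute' (adjTransposition i)
    (Matrix.of fun r c => (Pi.single (x c) 1 : Fin n → k) r)
  have hs : Equiv.Perm.sign (adjTransposition i) = -1 :=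
    Equiv.Perm.sign_swap (by simp [Fin.ext_iff])
  rw [hs] at h
  refine Eq.trans ?_ (h.trans (by simp))
  rfl

theorem eval_jelly_jelly (w : Equiv.Perm (Fin n) → List (Fin (n - 1)))
    (hw : ∀ σ, wordPerm (w σ) = σ) :
    eval (Term.tens .jelly .jelly : Term k n (n + n) (0 + 0)) =
      eval (Term.listSum ((Finset.univ : Finset (Equiv.Perm (Fin n))).toList.map fun σ =>
          .smul ((Equiv.Perm.sign σ : ℤ) : k)
            (.comp (.tens (Term.permWord (w σ)) (.one n)) (Term.crosscap n)))) := by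
  refine ext_append fun x y => ?_
  rw [eval_listSum, List.map_map, Finset.sum_map_toList, LinearMap.sum_apply]
  have hσ : ∀ σ : Equiv.Perm (Fin n),
      eval (.smul ((Equiv.Perm.sign σ : ℤ) : k)
        (.comp (.tens (Term.permWord (w σ)) (.one n)) (Term.crosscap n)) : Term k n (n + n) 0)
        (vec (Fin.append x y)) =
      (((Equiv.Perm.sign σ : ℤ) : k) * if x ∘ (σ⁻¹ : Equiv.Perm _) = y then 1 else 0) •
        vec ![] := by
    intro σ
    simp only [eval, LinearMap.smul_apply, LinearMap.comp_apply]
    rw [tmulMap_vec, eval_permWord, hw, LinearMap.id_apply, tmul_vec, eval_crosscap, smul_smul]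
  refine Eq.trans ?_ (Finset.sum_congr rfl fun σ _ => (hσ σ).symm)
  rw [eval, tmulMap_vec, eval, detMap_vec, detMap_vec, smul_tmul, tmul_smul, smul_smul,
    ← Finset.sum_smul]
  have e4 : (tmul (vec ![] : TP k n 0) (vec ![] : TP k n 0) : TP k n (0 + 0)) = vec ![] :=
    tmul_right _
  rw [e4]
  congr 1
  rw [← Matrix.det_transpose, ← Matrix.det_mul, Matrix.det_apply']
  refine Fintype.sum_equiv (Equiv.inv _) _ _ fun σ => ?_
  simp only [Equiv.inv_apply, Equiv.Perm.sign_inv, inv_inv]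
  congr 1
  have : ∀ i j, ((Matrix.of fun r c => (Pi.single (x c) 1 : Fin n → k) r).transpose *
      Matrix.of fun r c => (Pi.single (y c) 1 : Fin n → k) r) i j = if x i = y j then 1 else 0 := by
    intro i j
    simp [Matrix.mul_apply, Pi.single_apply, eq_comm]
  simp only [this]
  rw [Fintype.prod_ite_zero]
  simp [funext_iff]

theorem comp_val {a b c : ℕ} {f : Term k n a b} {g : Term k n b c} {x : TP k n a}
    {y : TP k n b} {z : TP k n c} (h : eval f x = y) (h' : eval g y = z) :
    eval (f.comp g) x = z := by rw [eval, LinearMap.comp_apply, h, h']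

/-- Equal morphisms of `JP(n)` have the same linear map. -/
theorem eval_eq {a b : ℕ} {t t' : Term k n a b} (h : Rel t t') : eval t = eval t' := by
  induction h with
  | refl f => rfl
  | symm _ ih => exact ih.symm
  | trans _ _ ih ih' => exact ih.trans ih'
  | comp_congr _ _ ih ih' => rw [eval, eval, ih, ih']
  | tensor_congr _ _ ih ih' => rw [eval, eval, ih, ih']
  | add_congr _ _ ih ih' => rw [eval, eval, ih, ih']
  | smul_congr _ _ ih => rw [eval, eval, ih]
  | id_comp f => rfl
  | comp_id f => rfl
  | assoc f g h => rfl
  | add_assoc f g h => exact add_assoc _ _ _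
  | add_comm f g => exact add_comm _ _
  | zero_add f => exact zero_add _
  | smul_add r f g => exact smul_add _ _ _
  | add_smul r s f => exact add_smul _ _ _
  | mul_smul r s f => exact mul_smul _ _ _
  | one_smul f => exact one_smul _ _
  | zero_smul f => exact zero_smul _ _
  | add_comp f f' g => exact LinearMap.comp_add _ _ _
  | comp_add f g g' => exact LinearMap.add_comp _ _ _
  | smul_comp r f g => exact LinearMap.comp_smul _ _ _
  | comp_smul r f g => exact LinearMap.smul_comp _ _ _
  | add_tensor f f' g =>
    refine ext_tmul fun x y => ?_
    simp only [eval, LinearMap.add_apply, tmulMap_tmul, add_tmul]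
  | tensor_add f g g' =>
    refine ext_tmul fun x y => ?_
    simp only [eval, LinearMap.add_apply, tmulMap_tmul, tmul_add]
  | smul_tensor r f g =>
    refine ext_tmul fun x y => ?_
    simp only [eval, LinearMap.smul_apply, tmulMap_tmul, smul_tmul]
  | tensor_smul r f g =>
    refine ext_tmul fun x y => ?_
    simp only [eval, LinearMap.smul_apply, tmulMap_tmul, tmul_smul]
  | tensor_id a b =>
    refine ext_tmul fun x y => ?_
    simp only [eval, tmulMap_tmul, LinearMap.id_apply]
  | interchange f g f' g' =>
    refine ext_tmul fun x y => ?_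
    simp only [eval, tmulMap_tmul, LinearMap.comp_apply]
  | tensor_assoc x y z =>
    rw [eval_cast]
    refine ext_append fun i j => ?_
    obtain ⟨j, l, rfl⟩ : ∃ j' l, j = Fin.append j' l := ⟨_, _, Fin.append_castAdd_natAdd.symm⟩
    rw [← tmul_vec, ← tmul_vec]
    simp only [LinearMap.comp_apply, LinearEquiv.coe_coe, eval]
    have h1 : tcast k n (Nat.add_assoc _ _ _).symm (tmul (vec i) (tmul (vec j) (vec l))) =
        tmul (tmul (vec i) (vec j)) (vec l : TP k n _) :=
      (tcast k n (Nat.add_assoc _ _ _)).injective (by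
        rw [tcast_tmul_assoc]; simp [tcast])
    rw [h1, tmulMap_tmul, tmulMap_tmul, tcast_tmul_assoc, tmulMap_tmul, tmulMap_tmul]
  | tensor_unit f =>
    refine LinearMap.ext fun x => ?_
    have h := tmulMap_tmul (eval f) (LinearMap.id : TP k n 0 →ₗ[k] TP k n 0) x (vec ![])
    rw [LinearMap.id_apply, tmul_right, tmul_right] at h
    exact h
  | unit_tensor f =>
    rw [eval_cast]
    refine LinearMap.ext fun x => ?_
    have h1 : tcast k n (Nat.zero_add _).symm x = tmul (vec ![]) x :=
      (tcast k n (Nat.zero_add _)).injective (by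
        rw [tcast_tmul_left]; simp [tcast])
    simp only [LinearMap.comp_apply, LinearEquiv.coe_coe, eval]
    rw [h1, tmulMap_tmul, LinearMap.id_apply, tcast_tmul_left]
  | swap_swap => exact ext2_vec fun x y => comp_val (swapMap_vec x y) (swapMap_vec y x)
  | braid =>
    exact ext3_vec fun x y z =>
      (comp_val (id_swap x y z) (comp_val (swap_id x z y) (id_swap z x y))).trans
        (comp_val (swap_id x y z) (comp_val (id_swap y x z) (swap_id y z x))).symm
  | eta_swap =>
    refine ext1_vec fun x => (comp_val (id_eta x) ?_).trans (eta_id x).symm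
    exact (map_sum _ _ _).trans (Finset.sum_congr rfl fun y _ => swapMap_vec x y)
  | mu_swap =>
    refine ext3_vec fun x y z =>
      (comp_val (id_swap x y z) (comp_val (swap_id x z y) (id_mu z x y))).trans
        (comp_val (mu_id x y z) ?_).symm
    split_ifs
    · exact swapMap_vec _ _
    · exact map_zero _
  | eps_swap =>
    exact ext2_vec fun x y => (comp_val (swapMap_vec x y) (id_eps y x)).trans (eps_id x y).symm
  | delta_swap =>
    exact ext2_vec fun x y =>
      (comp_val (id_delta x y) (comp_val (swap_id x y y) (id_swap y x y))).trans
        (comp_val (swapMap_vec x y) (delta_id y x)).symm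
  | unit =>
    refine ext1_vec fun x => comp_val (id_eta x) ?_
    refine (map_sum _ _ _).trans ?_
    refine (Finset.sum_congr rfl fun y _ => muMap_vec x y).trans ?_
    simp [eval]
  | counit_right => exact ext1_vec fun x => comp_val (deltaMap_vec x) (id_eps x x)
  | counit_left => exact ext1_vec fun x => comp_val (deltaMap_vec x) (eps_id x x)
  | frobenius_left =>
    refine ext2_vec fun x y => (comp_val (id_delta x y) (mu_id x y y)).trans
      (comp_val (muMap_vec x y) ?_).symm
    split_ifs with h
    · subst h; exact deltaMap_vec _
    · exact map_zero _
  | frobenius_right =>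
    refine ext2_vec fun x y => (comp_val (delta_id x y) (id_mu x x y)).trans
      (comp_val (muMap_vec x y) ?_).symm
    split_ifs with h
    · subst h; exact deltaMap_vec _
    · exact map_zero _
  | commutative =>
    refine ext2_vec fun x y => ?_
    simp only [eval, LinearMap.comp_apply, swapMap_vec, muMap_vec]
    by_cases h : x = y
    · simp [h]
    · simp [h, Ne.symm h]
  | special =>
    refine ext1_vec fun x => ?_
    simp only [eval, LinearMap.comp_apply, deltaMap_vec, muMap_vec]
    simp
  | dimension =>
    refine ext_vec fun i => ?_
    rw [vec_zero i]
    simp [eval, etaMap_vec, epsMap_vec, Nat.cast_smul_eq_nsmul]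
  | jelly_swim => exact eval_jelly_swim
  | jelly_skew i => exact eval_jelly_skew i
  | jelly_jelly w hw => exact eval_jelly_jelly w hw

end Sound
section Functor

variable {k : Type u} [Field k] {n : ℕ}

/-! ## The functor `Ψ` -/

theorem permRep_single (σ : Equiv.Perm (Fin n)) (x : Fin n) :
    permRep k n σ (Pi.single x 1) = Pi.single (σ x) 1 := by
  funext r
  simp [permRep, LinearMap.funLeft_apply, Pi.single_apply, Equiv.symm_apply_eq]

theorem tensorRep_tprod {a : ℕ} (σ : Equiv.Perm (Fin n)) (v : Fin a → Fin n → k) :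
    tensorRep k n a σ (PiTensorProduct.tprod k v) =
      PiTensorProduct.tprod k fun r => permRep k n σ (v r) :=
  PiTensorProduct.map_tprod _ _

theorem tensorRep_vec {a : ℕ} (σ : Equiv.Perm (Fin n)) (i : Fin a → Fin n) :
    tensorRep k n a σ (vec i) = vec (σ ∘ i) := by
  rw [vec, tensorRep_tprod]
  simp only [permRep_single]
  rfl

theorem tensorRep_tmul {a b : ℕ} (σ : Equiv.Perm (Fin n)) (x : TP k n a) (y : TP k n b) :
    tensorRep k n (a + b) σ (tmul x y) = tmul (tensorRep k n a σ x) (tensorRep k n b σ y) := by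
  have h : tensorRep k n (a + b) σ = tmulMap (tensorRep k n a σ) (tensorRep k n b σ) := by
    refine ext_append fun i j => ?_
    rw [tmulMap_vec, tensorRep_vec, tensorRep_vec, tensorRep_vec, tmul_vec]
    congr 1
    funext r
    refine Fin.addCases (fun r => ?_) (fun r => ?_) r <;> simp
  rw [h, tmulMap_tmul]

/-- The linear map of a morphism is `A_n`-equivariant. -/
theorem eval_equivariant {a b : ℕ} (t : Term k n a b) (σ : Equiv.Perm (Fin n))
    (hσ : Equiv.Perm.sign σ = 1) : eval t ∘ₗ tensorRep k n a σ = tensorRep k n b σ ∘ₗ eval t := by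
  induction t with
  | one a => rfl
  | comp f g ihf ihg =>
    rw [eval, LinearMap.comp_assoc, ihf, ← LinearMap.comp_assoc, ihg, LinearMap.comp_assoc]
  | tens f g ihf ihg =>
    refine ext_tmul fun x y => ?_
    have hf := LinearMap.congr_fun ihf x
    have hg := LinearMap.congr_fun ihg y
    simp only [LinearMap.comp_apply] at hf hg ⊢
    rw [tensorRep_tmul, eval, tmulMap_tmul, tmulMap_tmul, tensorRep_tmul, hf, hg]
  | zero a b => rw [eval, LinearMap.zero_comp, LinearMap.comp_zero]
  | add f g ihf ihg => rw [eval, LinearMap.add_comp, LinearMap.comp_add, ihf, ihg]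
  | smul r f ihf => rw [eval, LinearMap.smul_comp, LinearMap.comp_smul, ihf]
  | mu =>
    refine ext_vec fun i => ?_
    simp only [LinearMap.comp_apply, eval, tensorRep_vec, muMap, onVec_vec, Function.comp_apply,
      EmbeddingLike.apply_eq_iff_eq]
    split_ifs
    · rw [tensorRep_vec]
      exact congrArg vec (by funext r; fin_cases r; rfl)
    · simp
  | eta =>
    refine ext_vec fun i => ?_
    simp only [LinearMap.comp_apply, eval, tensorRep_vec, etaMap, onVec_vec, map_sum]
    refine Fintype.sum_equiv σ.symm _ _ fun x => congrArg vec ?_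
    funext r; fin_cases r; simp
  | delta =>
    refine ext_vec fun i => ?_
    simp only [LinearMap.comp_apply, eval, tensorRep_vec, deltaMap, onVec_vec]
    exact congrArg vec (by funext r; fin_cases r <;> rfl)
  | eps =>
    refine ext_vec fun i => ?_
    simp only [LinearMap.comp_apply, eval, tensorRep_vec, epsMap, onVec_vec]
    exact congrArg vec (Subsingleton.elim _ _)
  | swap =>
    refine ext_vec fun i => ?_
    simp only [LinearMap.comp_apply, eval, tensorRep_vec, swapMap, onVec_vec]
    exact congrArg vec (by funext r; fin_cases r <;> rfl)
  | jelly =>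
    refine ext_vec fun i => ?_
    simp only [LinearMap.comp_apply, eval, tensorRep_vec, detMap, onVec_vec, map_smul]
    rw [vec_zero (σ ∘ ![])]
    congr 1
    have h := Matrix.det_permute (σ⁻¹ : Equiv.Perm (Fin n))
      (Matrix.of fun r c => (Pi.single (i c) 1 : Fin n → k) r)
    rw [Equiv.Perm.sign_inv, hσ] at h
    refine Eq.trans ?_ (h.trans (by simp))
    congr 1
    ext r c
    simp [Pi.single_apply, Equiv.symm_apply_eq]

/-- The intertwining map of a formal expression. -/
def evalHom {a b : ℕ} (t : Term k n a b) :
    (altTensorRep k n a).IntertwiningMap (altTensorRep k n b) :=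
  ⟨eval t, fun σ => eval_equivariant t σ.1 (Equiv.Perm.mem_alternatingGroup.mp σ.2)⟩

variable (k n) in
/-- The functor `Ψ : JP(n) ⥤ Rep(A_n)`: it sends the object `a` to `V^{⊗a}`, the partition
generators to the usual maps between tensor powers of `V`, and `j` to the determinant. -/
def Psi : JP k n ⥤ Rep.{u} k (alternatingGroup (Fin n)) where
  obj X := Rep.of (altTensorRep k n X.strands)
  map {X Y} f := Rep.ofHom (Quotient.lift evalHom (fun t t' h => by
    simp only [evalHom, eval_eq h]) (f : HomSet k n X.strands Y.strands))
  map_id _ := rfl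
  map_comp f g := by
    induction f using Quotient.inductionOn
    induction g using Quotient.inductionOn
    rfl

theorem Psi_map_ofTerm {X Y : JP k n} (t : Term k n X.strands Y.strands) :
    (Psi k n).map (JP.ofTerm t : X ⟶ Y) = Rep.ofHom (evalHom t) := rfl

instance : (Psi k n).Additive where
  map_add {X Y f g} := by
    obtain ⟨f, rfl⟩ := JP.ofTerm_surjective f
    obtain ⟨g, rfl⟩ := JP.ofTerm_surjective g
    rfl

instance : (Psi k n).Linear k where
  map_smul {X Y} f r := by
    obtain ⟨f, rfl⟩ := JP.ofTerm_surjective f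
    rfl

theorem isEmptyEquiv_symm_one :
    (PiTensorProduct.isEmptyEquiv (Fin 0)).symm (1 : k) = (vec ![] : TP k n 0) := by
  rw [LinearEquiv.symm_apply_eq, vec, PiTensorProduct.isEmptyEquiv_apply_tprod]

/-- The unit isomorphism `k ≅ V^{⊗0}`, `1 ↦ v_{()}`. -/
def unitEquiv : (Representation.trivial k (alternatingGroup (Fin n)) k).Equiv
    (altTensorRep k n 0) :=
  .mk (PiTensorProduct.isEmptyEquiv (Fin 0)).symm fun σ => by
    ext
    simp only [LinearMap.comp_apply, LinearEquiv.coe_coe, Representation.trivial_apply]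
    rw [isEmptyEquiv_symm_one]
    exact ((tensorRep_vec σ.1 ![]).trans (vec_zero _)).symm

/-- The tensorator `V^{⊗a} ⊗ V^{⊗b} ≅ V^{⊗(a+b)}`. -/
def tensorEquiv (a b : ℕ) : ((altTensorRep k n a).tprod (altTensorRep k n b)).Equiv
    (altTensorRep k n (a + b)) :=
  .mk TensorPower.mulEquiv fun σ => TensorProduct.ext' fun x y =>
    (tensorRep_tmul σ.1 x y).symm

theorem Psi_map_eqToHom {X Y : JP k n} (h : X = Y) (x : TP k n X.strands) :
    ((Psi k n).map (eqToHom h)).hom x = tcast k n (congrArg JP.strands h) x := by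
  subst h
  exact (tcast_rfl rfl x).symm

theorem isEmptyEquiv_symm_apply (r : k) :
    (PiTensorProduct.isEmptyEquiv (Fin 0)).symm r = r • (vec ![] : TP k n 0) := by
  rw [← isEmptyEquiv_symm_one, ← map_smul, smul_eq_mul, mul_one]

theorem left_unitality_aux {a : ℕ} (r : k) (x : TP k n a) :
    tcast k n (Nat.zero_add a) (tmul ((PiTensorProduct.isEmptyEquiv (Fin 0)).symm r) x) =
      r • x := by
  rw [isEmptyEquiv_symm_apply, smul_tmul, map_smul, tcast_tmul_left]

theorem right_unitality_aux {a : ℕ} (r : k) (x : TP k n a) :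
    tcast k n (Nat.add_zero a) (tmul x ((PiTensorProduct.isEmptyEquiv (Fin 0)).symm r)) =
      r • x := by
  rw [isEmptyEquiv_symm_apply, tmul_smul, map_smul, tmul_right]
  exact congrArg (r • ·) (tcast_rfl _ x)

variable (k n) in
/-- The monoidal structure of `Ψ`. -/
def PsiCore : (Psi k n).CoreMonoidal where
  εIso := Rep.mkIso unitEquiv
  μIso X Y := Rep.mkIso (tensorEquiv X.strands Y.strands)
  μIso_hom_natural_left {X Y} f Z := by
    obtain ⟨f, rfl⟩ := JP.ofTerm_surjective f
    refine Rep.hom_ext (Representation.IntertwiningMap.ext (TensorProduct.ext' fun x y => ?_))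
    exact (tmulMap_tmul (eval f) LinearMap.id x y).symm
  μIso_hom_natural_right {X Y} Z f := by
    obtain ⟨f, rfl⟩ := JP.ofTerm_surjective f
    refine Rep.hom_ext (Representation.IntertwiningMap.ext (TensorProduct.ext' fun x y => ?_))
    exact (tmulMap_tmul LinearMap.id (eval f) x y).symm
  associativity X Y Z := by
    refine Rep.hom_ext (Representation.IntertwiningMap.ext
      (TensorProduct.ext_threefold fun x y z => ?_))
    exact (Psi_map_eqToHom (X := (X ⊗ Y) ⊗ Z) (Y := X ⊗ Y ⊗ Z)
      (congrArg JP.mk (Nat.add_assoc _ _ _)) (tmul (tmul x y) z)).trans (tcast_tmul_assoc x y z)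
  left_unitality X := by
    refine Rep.hom_ext (Representation.IntertwiningMap.ext (TensorProduct.ext' fun r x => ?_))
    exact ((Psi_map_eqToHom (X := 𝟙_ _ ⊗ X) (Y := X) (congrArg JP.mk (Nat.zero_add _))
      (tmul ((PiTensorProduct.isEmptyEquiv (Fin 0)).symm r) x)).trans
        (left_unitality_aux r x)).symm
  right_unitality X := by
    refine Rep.hom_ext (Representation.IntertwiningMap.ext (TensorProduct.ext' fun x r => ?_))
    exact ((Psi_map_eqToHom (X := X ⊗ 𝟙_ _) (Y := X) (congrArg JP.mk (Nat.add_zero _))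
      (tmul x ((PiTensorProduct.isEmptyEquiv (Fin 0)).symm r))).trans
        (right_unitality_aux r x)).symm

instance : (Psi k n).Monoidal := (PsiCore k n).toMonoidal

/-! ## Generators and jellyfish diagrams -/

namespace JP

/-- The multiplication `μ : 2 → 1`. -/
def mu : (⟨2⟩ : JP k n) ⟶ ⟨1⟩ := ofTerm Term.mu

/-- The unit `η : 0 → 1`. -/
def eta : (⟨0⟩ : JP k n) ⟶ ⟨1⟩ := ofTerm Term.eta

/-- The comultiplication `Δ : 1 → 2`. -/
def delta : (⟨1⟩ : JP k n) ⟶ ⟨2⟩ := ofTerm Term.delta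

/-- The counit `ε : 1 → 0`. -/
def eps : (⟨1⟩ : JP k n) ⟶ ⟨0⟩ := ofTerm Term.eps

/-- The crossing `s : 2 → 2`. -/
def swap : (⟨2⟩ : JP k n) ⟶ ⟨2⟩ := ofTerm Term.swap

/-- The jellyfish `j : n → 0`. -/
def jelly : (⟨n⟩ : JP k n) ⟶ ⟨0⟩ := ofTerm Term.jelly

/-- The morphisms of `JP(n)` that are given by jellyfish diagrams: those obtained from identities,
the partition generators and the jellyfish by vertical and horizontal stacking (every partition
diagram is such a stacking of partition generators). -/
inductive IsJellyfishDiagram : {X Y : JP k n} → (X ⟶ Y) → Prop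
  | id (X : JP k n) : IsJellyfishDiagram (𝟙 X)
  | mu : IsJellyfishDiagram mu
  | eta : IsJellyfishDiagram eta
  | delta : IsJellyfishDiagram delta
  | eps : IsJellyfishDiagram eps
  | swap : IsJellyfishDiagram swap
  | jelly : IsJellyfishDiagram jelly
  | comp {X Y Z : JP k n} {f : X ⟶ Y} {g : Y ⟶ Z} :
      IsJellyfishDiagram f → IsJellyfishDiagram g → IsJellyfishDiagram (f ≫ g)
  | tensor {X Y X' Y' : JP k n} {f : X ⟶ Y} {g : X' ⟶ Y'} :
      IsJellyfishDiagram f → IsJellyfishDiagram g → IsJellyfishDiagram (f ⊗ₘ g)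

end JP

/-- The linear map `V^{⊗a} → V^{⊗b}` that underlies `Ψ(f)`, for `f : a → b` in `JP(n)`. -/
def PsiMap {X Y : JP k n} (f : X ⟶ Y) : TP k n X.strands →ₗ[k] TP k n Y.strands :=
  ((Psi k n).map f).hom.toLinearMap

end Functor
end Jellyfish

end

noncomputable section

/-! Well-definedness of the functor is already contained in `Psi`, through `eval_eq` and
`eval_equivariant`; the substance of this part is fullness.

The matrix of a linear map `V^{⊗a} → V^{⊗b}` is a function on tuples in `Fin (a + b) → Fin n`, and
the map is recovered from the corresponding functional on `V^{⊗(a+b)}` by bending `b` strands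
(`isRealized_of_matrix_mem`). If the map is `A_n`-equivariant, this function is constant on
`A_n`-orbits of tuples. So it suffices that every `A_n`-invariant function of `m` variables in `Fin
n` comes from a combination of diagrams.

The functions that do so form a subalgebra `realizedFun` of all functions: strands can be
duplicated, so two functionals can be evaluated on the same tuple and multiplied. It is closed under
substitution of variables and under summing out the last variable, and it contains the equality test
of two variables (the cap) and the determinant (the jellyfish).

Two tuples lie in one `S_n`-orbit exactly when they have the same pattern of equal entries, so
products of equality tests and their complements give the indicators of `S_n`-orbits. If `z` misses
two values, the transposition of these fixes `z`, and the `A_n`-orbit is the whole `S_n`-orbit. If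
`z` misses at most one value, then `σ ∘ z` determines `σ`. The determinant, read at positions where
`z` takes each value, then gives the function `σ ∘ z ↦ sign σ` on the orbit; a single missing value
is first appended to `z` and then summed out. Half the sum of this function and the orbit indicator
is the indicator of the `A_n`-orbit, and here `char k ≠ 2` enters
(`alternating_orbit_mem_realizedFun`). Invariant functions are linear combinations of such
indicators. -/

namespace Jellyfish

/-! ### Linear maps given by formal expressions -/

section Realized

variable {k : Type u} [Field k] {n : ℕ}

/-- A linear map between tensor powers of `V` that is given by a formal expression. -/
def IsRealized {a b : ℕ} (f : TP k n a →ₗ[k] TP k n b) : Prop := ∃ t : Term k n a b, eval t = f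

namespace IsRealized

theorem id (a : ℕ) : IsRealized (LinearMap.id : TP k n a →ₗ[k] TP k n a) := ⟨.one a, rfl⟩

theorem comp {a b c : ℕ} {g : TP k n b →ₗ[k] TP k n c} {f : TP k n a →ₗ[k] TP k n b}
    (hg : IsRealized g) (hf : IsRealized f) : IsRealized (g ∘ₗ f) := by
  obtain ⟨t, rfl⟩ := hg
  obtain ⟨s, rfl⟩ := hf
  exact ⟨s.comp t, rfl⟩

theorem tmulMap {a b c d : ℕ} {f : TP k n a →ₗ[k] TP k n b} {g : TP k n c →ₗ[k] TP k n d}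
    (hf : IsRealized f) (hg : IsRealized g) : IsRealized (tmulMap f g) := by
  obtain ⟨s, rfl⟩ := hf
  obtain ⟨t, rfl⟩ := hg
  exact ⟨s.tens t, rfl⟩

end IsRealized

variable (k n) in
/-- The linear maps `V^{⊗a} → V^{⊗b}` that are given by formal expressions. -/
def realized (a b : ℕ) : Submodule k (TP k n a →ₗ[k] TP k n b) where
  carrier := {f | IsRealized f}
  zero_mem' := ⟨.zero a b, rfl⟩
  add_mem' := by
    rintro _ _ ⟨s, rfl⟩ ⟨t, rfl⟩
    exact ⟨s.add t, rfl⟩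
  smul_mem' := by
    rintro r _ ⟨t, rfl⟩
    exact ⟨t.smul r, rfl⟩

/-! ### Rearranging, copying and forgetting strands -/

/-- The map `v_x ↦ v_{x ∘ φ}` that rearranges, copies and forgets tensor factors. -/
def pull {a b : ℕ} (φ : Fin b → Fin a) : TP k n a →ₗ[k] TP k n b := onVec fun x => vec (x ∘ φ)

theorem pull_vec {a b : ℕ} (φ : Fin b → Fin a) (x : Fin a → Fin n) :
    pull φ (vec x : TP k n a) = vec (x ∘ φ) := onVec_vec _ _

theorem append_snoc_eq {α : Type*} {a : ℕ} (x : Fin (a + 1) → α) :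
    ∃ (u : Fin a → α) (c : α), x = Fin.append u ![c] :=
  ⟨fun i => x (Fin.castAdd 1 i), x (Fin.natAdd a 0), by
    funext r
    refine Fin.addCases (fun r => ?_) (fun r => ?_) r
    · simp
    · rw [Subsingleton.elim r 0]; simp⟩

theorem comp_append {α β : Type*} {a b : ℕ} (f : α → β) (u : Fin a → α) (v : Fin b → α) :
    f ∘ Fin.append u v = Fin.append (f ∘ u) (f ∘ v) := by
  funext r
  simp only [Function.comp_apply, append_eq]
  split_ifs <;> rfl

theorem isRealized_pull_perm {a : ℕ} (σ : Equiv.Perm (Fin a)) :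
    IsRealized (pull σ : TP k n a →ₗ[k] TP k n a) := by
  -- A word acts on `vec x` by precomposing `x` with the inverse of its permutation, hence a word
  -- for `σ⁻¹`.
  obtain ⟨w, hw⟩ := exists_wordPerm σ⁻¹
  refine ⟨Term.permWord w, ext_vec fun x => ?_⟩
  rw [eval_permWord, pull_vec, hw, inv_inv]

/-- This map is `ε^{⊗a}`, built up one strand at a time. -/
theorem isRealized_pull_elim (a : ℕ) (φ : Fin 0 → Fin a) :
    IsRealized (pull φ : TP k n a →ₗ[k] TP k n 0) := by
  induction a with
  | zero =>
    refine ⟨.one 0, ext_vec fun x => ?_⟩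
    rw [pull_vec, eval, LinearMap.id_apply, vec_zero x, vec_zero (x ∘ φ)]
  | succ a ih =>
    have h := (ih Fin.elim0).tmulMap (⟨.eps, rfl⟩ : IsRealized (epsMap : TP k n 1 →ₗ[k] TP k n 0))
    convert h using 1
    refine ext_append fun u c => ?_
    refine Eq.trans ?_ (tmulMap_vec (b := 0) (d := 0) _ _ _ _).symm
    rw [pull_vec, pull_vec, epsMap, onVec_vec, vec_zero (_ ∘ _), vec_zero (u ∘ _)]
    exact (tmul_right _).symm

/-- The map that copies the tensor factor `p` to the right end. -/
theorem isRealized_pull_copy {a : ℕ} (p : Fin a) :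
    IsRealized (pull (Fin.append _root_.id ![p]) : TP k n a →ₗ[k] TP k n (a + 1)) := by
  obtain _ | a := a
  · exact p.elim0
  -- `Δ` on the right end duplicates only the last factor. So factor `p` is swapped into the last
  -- place, duplicated there, and the swap is undone on the first `a + 1` factors, leaving the new
  -- copy at the end.
  let σ : Equiv.Perm (Fin (a + 1)) := Equiv.swap p (Fin.last a)
  have h1 : IsRealized (tmulMap LinearMap.id deltaMap : TP k n (a + 1) →ₗ[k] TP k n (a + 2)) :=
    (IsRealized.id a).tmulMap ⟨.delta, rfl⟩
  have h2 : IsRealized (tmulMap (pull σ) LinearMap.id :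
      TP k n (a + 1 + 1) →ₗ[k] TP k n (a + 1 + 1)) :=
    (isRealized_pull_perm σ).tmulMap (.id 1)
  convert h2.comp (h1.comp (isRealized_pull_perm σ)) using 1
  refine ext_vec fun x => ?_
  rw [LinearMap.comp_apply, LinearMap.comp_apply, pull_vec, pull_vec]
  obtain ⟨u, c, hu⟩ := append_snoc_eq (x ∘ σ)
  have hx : x = Fin.append u ![c] ∘ σ := by
    rw [← hu]; funext r; simp [σ]
  have hc : c = x p := by
    rw [hx]; simp [σ, append_eq]
  rw [hu, tmulMap_vec, LinearMap.id_apply, deltaMap, onVec_vec, tmul_vec]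
  have e : (Fin.append u ![![c] 0, ![c] 0] : Fin (a + 2) → Fin n) =
      Fin.append (Fin.append u ![c]) ![c] := by
    funext r
    have := r.2
    simp only [append_eq]
    split_ifs with h1 h2 h3
    · rfl
    · omega
    · have h4 : r.val = a := by omega
      simp [h4]
    · have h4 : r.val = a + 1 := by omega
      simp [h4]
  rw [e]
  refine Eq.trans ?_ (tmulMap_vec _ _ _ _).symm
  rw [LinearMap.id_apply, pull_vec, ← hx, hc, comp_append]
  refine Eq.trans ?_ (tmul_vec _ _).symm
  congr 2
  funext r; fin_cases r; rfl

/-- The target strands are produced from the right: the source `p` of the last one is copied to the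
right end, and the remaining map `ψ` is applied to the original `a` strands. When no target strand
is left, the original strands are capped off by `ε`. -/
theorem isRealized_pull {a b : ℕ} (φ : Fin b → Fin a) :
    IsRealized (pull φ : TP k n a →ₗ[k] TP k n b) := by
  induction b with
  | zero => exact isRealized_pull_elim a φ
  | succ b ih =>
    obtain ⟨ψ, p, rfl⟩ := append_snoc_eq φ
    convert ((ih ψ).tmulMap (.id 1)).comp (isRealized_pull_copy p) using 1
    refine ext_vec fun x => ?_
    rw [LinearMap.comp_apply, pull_vec, pull_vec, comp_append, comp_append, tmulMap_vec, pull_vec,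
      LinearMap.id_apply, tmul_vec]
    rfl

/-! ### The algebra of functions given by diagrams -/

/-- The functional on `V^{⊗m}` with prescribed values on the basis vectors, with values in
`V^{⊗0}`. -/
def functional {m : ℕ} : ((Fin m → Fin n) → k) →ₗ[k] (TP k n m →ₗ[k] TP k n 0) where
  toFun F := onVec fun w => F w • vec ![]
  map_add' F G := ext_vec fun w => by
    simp only [onVec_vec, LinearMap.add_apply, Pi.add_apply, add_smul]
  map_smul' r F := ext_vec fun w => by
    simp only [onVec_vec, LinearMap.smul_apply, Pi.smul_apply, smul_eq_mul, mul_smul,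
      RingHom.id_apply]

theorem functional_vec {m : ℕ} (F : (Fin m → Fin n) → k) (w : Fin m → Fin n) :
    functional F (vec w) = F w • vec ![] := onVec_vec _ _

/-- Rearranging strands is dual to substituting variables. As `φ` is arbitrary, variables may be
repeated or left out; this is what makes the determinant usable at any choice of positions. -/
theorem functional_comp_pull {m m' : ℕ} (F : (Fin m → Fin n) → k) (φ : Fin m → Fin m') :
    functional (fun w => F (w ∘ φ)) = functional F ∘ₗ pull φ :=
  ext_vec fun w => by rw [LinearMap.comp_apply, pull_vec, functional_vec, functional_vec]

/-- Each basis vector `vec w` is duplicated to `vec w ⊗ vec w`, and each functional is evaluated on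
its own copy, so the scalars multiply. -/
theorem functional_mul {m : ℕ} (F G : (Fin m → Fin n) → k) :
    functional (F * G) = tmulMap (functional F) (functional G) ∘ₗ
      pull (Fin.append _root_.id _root_.id) :=
  ext_vec fun w => by
    rw [LinearMap.comp_apply, pull_vec, functional_vec, comp_append]
    refine Eq.trans ?_ (tmulMap_vec (b := 0) (d := 0) _ _ _ _).symm
    rw [Function.comp_id, functional_vec, functional_vec, tmul_smul, smul_tmul, smul_smul,
      Pi.mul_apply, mul_comm]
    exact congrArg _ (tmul_right _).symm

variable (k n) in
/-- The functions on the index set of the basis of `V^{⊗m}` whose functionals are given by formal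
expressions. They form an algebra. -/
def realizedFun (m : ℕ) : Subalgebra k ((Fin m → Fin n) → k) :=
  ((realized k n m 0).comap functional).toSubalgebra
    (by
      change IsRealized _
      -- The constant function `1` corresponds to forgetting all strands.
      convert isRealized_pull (k := k) (n := n) (Fin.elim0 : Fin 0 → Fin m) using 1
      refine ext_vec fun w => ?_
      rw [functional_vec, pull_vec, vec_zero (w ∘ _), Pi.one_apply, one_smul])
    (fun F G hF hG => by
      change IsRealized _
      rw [functional_mul]
      exact (IsRealized.tmulMap hF hG).comp (isRealized_pull _))

theorem mem_realizedFun {m : ℕ} {F : (Fin m → Fin n) → k} :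
    F ∈ realizedFun k n m ↔ IsRealized (functional F) := Iff.rfl

theorem comp_mem_realizedFun {m m' : ℕ} {F : (Fin m → Fin n) → k} (hF : F ∈ realizedFun k n m)
    (φ : Fin m → Fin m') : (fun w : Fin m' → Fin n => F (w ∘ φ)) ∈ realizedFun k n m' := by
  rw [mem_realizedFun, functional_comp_pull]
  exact IsRealized.comp hF (isRealized_pull _)

/-- Since `η` is the sum of all `v_y`, feeding it into the last strand sums out the last variable.
-/
theorem sum_append_mem_realizedFun {m : ℕ} {F : (Fin (m + 1) → Fin n) → k}
    (hF : F ∈ realizedFun k n (m + 1)) :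
    (fun w : Fin m → Fin n => ∑ y, F (Fin.append w ![y])) ∈ realizedFun k n m := by
  have h : IsRealized (tmulMap LinearMap.id etaMap : TP k n (m + 0) →ₗ[k] TP k n (m + 1)) :=
    (IsRealized.id m).tmulMap ⟨.eta, rfl⟩
  rw [mem_realizedFun]
  convert (IsRealized.comp hF h : IsRealized (a := m) _) using 1
  refine ext_vec fun w => ?_
  -- There is no strand for `η` to act on: `V^{⊗(m+0)}` is `V^{⊗m}`, and `vec w` has to be read as
  -- its product with the unit vector of `V^{⊗0}`.
  have e : tmulMap LinearMap.id etaMap (vec w : TP k n (m + 0)) =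
      tmul (vec w) (etaMap (vec ![])) := by
    have h := tmulMap_tmul (LinearMap.id : TP k n m →ₗ[k] _) (etaMap : TP k n 0 →ₗ[k] _) (vec w)
      (vec ![])
    rwa [tmul_right] at h
  refine Eq.trans ?_ (congrArg (functional F) e).symm
  rw [etaMap_vec, tmul_sum, map_sum, functional_vec, Finset.sum_smul]
  refine Finset.sum_congr rfl fun y _ => ?_
  rw [tmul_vec, functional_vec]

/-- The cap tests two variables for equality; substitution moves the test to the positions `p` and
`q`. -/
theorem eq_mem_realizedFun {m : ℕ} (p q : Fin m) :
    (fun w : Fin m → Fin n => if w p = w q then (1 : k) else 0) ∈ realizedFun k n m := by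
  have h : (fun w : Fin 2 → Fin n => if w 0 = w 1 then (1 : k) else 0) ∈ realizedFun k n 2 := by
    refine mem_realizedFun.mpr ⟨Term.cap, ext2_vec fun x y => ?_⟩
    rw [eval_cap, functional_vec]
    rfl
  exact comp_mem_realizedFun h ![p, q]

theorem det_mem_realizedFun : (fun w : Fin n → Fin n =>
    Matrix.det (Matrix.of fun r c => (Pi.single (w c) 1 : Fin n → k) r)) ∈ realizedFun k n n :=
  mem_realizedFun.mpr ⟨.jelly, rfl⟩

/-- A map `V^{⊗a} → V^{⊗b}` is obtained from the functional on `V^{⊗(a+b)}` given by its matrix by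
bending `b` strands. -/
theorem isRealized_of_matrix_mem {a b : ℕ} (f : TP k n a →ₗ[k] TP k n b)
    (hf : (fun w : Fin (a + b) → Fin n => (vecBasis k n b).repr (f (vec (w ∘ Fin.castAdd b)))
      (w ∘ Fin.natAdd a)) ∈ realizedFun k n (a + b)) : IsRealized f := by
  -- This is `η^{⊗b}`, the sum of all basis vectors of `V^{⊗b}`.
  have hη : ∀ b : ℕ, IsRealized (onVec fun _ => ∑ y, vec y : TP k n 0 →ₗ[k] TP k n b) := by
    intro b
    induction b with
    | zero =>
      refine ⟨.one 0, ext_vec fun x => ?_⟩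
      rw [onVec_vec, Fintype.sum_unique, vec_zero default, vec_zero x]
      rfl
    | succ b ih =>
      convert ih.tmulMap (⟨.eta, rfl⟩ : IsRealized (etaMap : TP k n 0 →ₗ[k] TP k n 1)) using 1
      refine ext_vec fun x => ?_
      rw [onVec_vec, vec_zero x, ← tmul_right (vec ![])]
      refine Eq.trans ?_ (tmulMap_tmul (a := 0) (c := 0) _ _ _ _).symm
      rw [onVec_vec, etaMap_vec, sum_tmul]
      simp only [tmul_sum, tmul_vec]
      rw [← Fintype.sum_prod_type']
      refine (Fintype.sum_bijective (fun p : (Fin b → Fin n) × Fin n => Fin.append p.1 ![p.2])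
        ⟨?_, ?_⟩ _ _ fun _ => rfl).symm
      · rintro ⟨u, c⟩ ⟨v, d⟩ h
        exact Prod.ext_iff.mpr (append_single_inj.mp h)
      · intro x
        obtain ⟨u, c, rfl⟩ := append_snoc_eq x
        exact ⟨(u, c), rfl⟩
  have h1 : IsRealized (tmulMap LinearMap.id (onVec fun _ => ∑ y, vec y) :
      TP k n (a + 0) →ₗ[k] TP k n (a + b)) := (IsRealized.id a).tmulMap (hη b)
  -- Creating `∑ y, vec y` and then duplicating these `b` strands plays the role of `b` cups: `x ↦ ∑
  -- x ⊗ y ↦ ∑ x ⊗ y ⊗ y`. The functional then consumes `x ⊗ y` and leaves the matrix entry as the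
  -- coefficient of the second copy of `y`.
  have h2 := isRealized_pull (k := k) (n := n)
    (Fin.append _root_.id (Fin.natAdd a) : Fin (a + b + b) → Fin (a + b))
  have h3 : IsRealized (tmulMap (functional _) LinearMap.id :
    TP k n (a + b + b) →ₗ[k] TP k n (0 + b)) := IsRealized.tmulMap hf (.id b)
  -- The composite ends in `V^{⊗(0+b)}`; an identity diagram with its target recast leads back to
  -- `V^{⊗b}`.
  have h4 : IsRealized (tcast k n (Nat.zero_add b)).toLinearMap := by
    refine ⟨Term.cast rfl (Nat.zero_add b) (.one (0 + b)), ?_⟩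
    rw [eval_cast]
    ext1; simp [tcast, eval]
  convert (h4.comp (h3.comp (h2.comp h1)) : IsRealized (a := a) _) using 1
  refine ext_vec fun x => ?_
  have e' : tmulMap LinearMap.id (onVec fun _ => ∑ y, vec y) (vec x : TP k n (a + 0)) =
      tmul (vec x) (∑ y : Fin b → Fin n, vec y) := by
    have h := tmulMap_tmul (LinearMap.id : TP k n a →ₗ[k] _)
      (onVec fun _ => ∑ y, vec y : TP k n 0 →ₗ[k] TP k n b) (vec x) (vec ![])
    rwa [tmul_right, onVec_vec] at h
  simp only [LinearMap.comp_apply, LinearEquiv.coe_coe]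
  refine Eq.trans ?_ (congrArg _ (congrArg _ (congrArg _ e'))).symm
  rw [tmul_sum]
  simp only [map_sum, tmul_vec, pull_vec]
  have e : ∀ y : Fin b → Fin n, Fin.append x y ∘ Fin.append _root_.id (Fin.natAdd a) =
      Fin.append (Fin.append x y) y := by
    intro y
    rw [comp_append, Function.comp_id]
    congr 1
    funext r; simp
  simp only [e, tmulMap_vec, functional_vec, LinearMap.id_apply, smul_tmul, map_smul,
    tcast_tmul_left]
  refine ((vecBasis k n b).sum_repr (f (vec x))).symm.trans (Finset.sum_congr rfl fun y _ => ?_)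
  have e1 : Fin.append x y ∘ Fin.castAdd b = x := by funext r; simp
  have e2 : Fin.append x y ∘ Fin.natAdd a = y := by funext r; simp
  rw [vecBasis_apply, e1, e2]

end Realized

/-! ### Orbits of tuples and invariant functions -/

section Invariants

variable {k : Type u} [Field k] {n : ℕ}

/-- Because the patterns of equal entries agree, `z p ↦ w p` is a well-defined bijection between the
ranges, and a bijection between subsets of a finite set extends to a permutation. -/
theorem exists_perm_comp_eq {α β : Type*} [Finite β] {z w : α → β}
    (h : ∀ p q, z p = z q ↔ w p = w q) : ∃ σ : Equiv.Perm β, w = σ ∘ z := by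
  classical
  have := Fintype.ofFinite β
  let e : Set.range z ≃ Set.range w := Equiv.ofBijective
    (fun y => ⟨w y.2.choose, Set.mem_range_self _⟩)
    ⟨fun y y' hy => by
      have h' := (h _ _).mpr (Subtype.ext_iff.mp hy)
      rw [y.2.choose_spec, y'.2.choose_spec] at h'
      exact Subtype.ext h', fun ⟨_, p, rfl⟩ =>
        ⟨⟨z p, p, rfl⟩, Subtype.ext ((h _ _).mp (Set.mem_range_self p).choose_spec)⟩⟩
  refine ⟨e.extendSubtype, funext fun p => ?_⟩
  rw [Function.comp_apply, e.extendSubtype_apply_of_mem _ (Set.mem_range_self p)]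
  exact ((h _ _).mp (Set.mem_range_self (f := z) p).choose_spec).symm

open scoped Classical in
/-- The indicator function of the `S_n`-orbit of `z`. -/
theorem perm_orbit_mem_realizedFun {m : ℕ} (z : Fin m → Fin n) :
    (fun w : Fin m → Fin n => if ∃ σ : Equiv.Perm (Fin n), w = σ ∘ z then (1 : k) else 0) ∈
      realizedFun k n m := by
  -- The `S_n`-orbit of `z` consists of the tuples with the same pattern of equal entries. Each
  -- factor compares one pair of positions, and is the equality test or `1` minus it.
  have h : (∏ p : Fin m, ∏ q : Fin m, fun w : Fin m → Fin n =>
      if z p = z q ↔ w p = w q then (1 : k) else 0) ∈ realizedFun k n m := by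
    refine prod_mem fun p _ => prod_mem fun q _ => ?_
    by_cases hz : z p = z q
    · simpa only [hz, true_iff] using eq_mem_realizedFun p q
    · convert sub_mem (one_mem (realizedFun k n m)) (eq_mem_realizedFun p q) using 1
      funext w
      by_cases hw : w p = w q <;> simp [hz, hw]
  convert h using 1
  funext w
  simp only [Finset.prod_apply, Fintype.prod_ite_zero, Finset.prod_const_one]
  refine if_congr ⟨?_, exists_perm_comp_eq⟩ rfl rfl
  rintro ⟨σ, rfl⟩ p q
  simp

/-- The transpose of this matrix is the permutation matrix of `σ`. -/
theorem det_single_comp (σ : Equiv.Perm (Fin n)) :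
    Matrix.det (Matrix.of fun r c => (Pi.single (σ c) 1 : Fin n → k) r) =
      ((Equiv.Perm.sign σ : ℤ) : k) := by
  rw [← Matrix.det_permutation σ, ← Matrix.det_transpose]
  congr 1
  ext r c
  simp [PEquiv.toMatrix_apply, Pi.single_apply, eq_comm]

open scoped Classical in
/-- The signed indicator function of the orbit of a tuple that takes all values. -/
theorem signed_orbit_mem_realizedFun {m : ℕ} {z : Fin m → Fin n} (hz : Function.Surjective z) :
    ∃ F ∈ realizedFun k n m, (∀ σ : Equiv.Perm (Fin n), F (σ ∘ z) = ((Equiv.Perm.sign σ : ℤ) : k)) ∧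
      ∀ w, (¬ ∃ σ : Equiv.Perm (Fin n), w = σ ∘ z) → F w = 0 := by
  -- `p` chooses a position of `z` for every value, so `(σ ∘ z) ∘ p = σ` and the determinant read at
  -- these positions is `sign σ`. The orbit indicator removes all tuples outside the orbit.
  obtain ⟨p, hp⟩ := hz.hasRightInverse
  refine ⟨_, mul_mem (perm_orbit_mem_realizedFun z) (comp_mem_realizedFun det_mem_realizedFun p),
    fun σ => ?_, fun w hw => ?_⟩
  · rw [Pi.mul_apply, if_pos ⟨σ, rfl⟩, one_mul, ← det_single_comp σ]
    simp only [Function.comp_apply, hp _]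
  · rw [Pi.mul_apply, if_neg hw, zero_mul]

/-- The signed indicator function of the orbit of a tuple that misses at most one value. -/
theorem signed_orbit_mem_realizedFun_of_append {m : ℕ} {z : Fin m → Fin n} {c : Fin n}
    (hz : Function.Surjective (Fin.append z ![c])) :
    ∃ F ∈ realizedFun k n m, (∀ σ : Equiv.Perm (Fin n), F (σ ∘ z) = ((Equiv.Perm.sign σ : ℤ) : k)) ∧
      ∀ w, (¬ ∃ σ : Equiv.Perm (Fin n), w = σ ∘ z) → F w = 0 := by
  obtain ⟨F, hF, hF1, hF0⟩ := signed_orbit_mem_realizedFun (k := k) hz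
  have comp_eq : ∀ σ : Equiv.Perm (Fin n),
      σ ∘ Fin.append z ![c] = Fin.append (σ ∘ z) ![σ c] := by
    intro σ
    rw [comp_append]
    congr 1
    funext r; fin_cases r; rfl
  -- The signed indicator for the extended tuple is summed over its last entry. At `σ ∘ z` only the
  -- entry `σ c` contributes.
  refine ⟨_, sum_append_mem_realizedFun hF, fun σ => ?_, fun w hw => ?_⟩
  · rw [Finset.sum_eq_single (σ c), ← comp_eq, hF1]
    · refine fun y _ hy => hF0 _ ?_
      rintro ⟨τ, hτ⟩
      rw [comp_eq, append_single_inj] at hτ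
      obtain ⟨h, rfl⟩ := hτ
      -- Every value other than `c` is an entry of `z`, so `σ ∘ z = τ ∘ z` forces `σ` and `τ` to
      -- agree away from `c`, and then, being bijections, also at `c`.
      have hs : ∀ x, x ≠ c → τ x = σ x := by
        intro x hx
        obtain ⟨r, rfl⟩ := hz x
        induction r using Fin.addCases with
        | left r => simpa using (congrFun h r).symm
        | right r => simp at hx
      obtain ⟨x, hx⟩ := σ.surjective (τ c)
      rcases eq_or_ne x c with rfl | hxc
      · exact hy hx.symm
      · exact hxc (τ.injective ((hs x hxc).trans hx))
    · simp
  · refine Finset.sum_eq_zero fun y _ => hF0 _ ?_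
    rintro ⟨τ, hτ⟩
    rw [comp_eq, append_single_inj] at hτ
    exact hw ⟨τ, hτ.1⟩

open scoped Classical in
/-- The indicator function of the `A_n`-orbit of `z`. -/
theorem alternating_orbit_mem_realizedFun (hk : ringChar k ≠ 2) (hn : 0 < n) {m : ℕ}
    (z : Fin m → Fin n) :
    (fun w : Fin m → Fin n => if ∃ σ ∈ alternatingGroup (Fin n), w = σ ∘ z then (1 : k) else 0) ∈
      realizedFun k n m := by
  by_cases hz : ∃ c, Function.Surjective (Fin.append z ![c])
  · obtain ⟨c, hz⟩ := hz
    obtain ⟨F, hF, hF1, hF0⟩ := signed_orbit_mem_realizedFun_of_append (k := k) hz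
    -- On the orbit this is `(1 + sign σ) / 2`, which is `1` for even and `0` for odd permutations.
    convert Subalgebra.smul_mem _ (add_mem (perm_orbit_mem_realizedFun z) hF) (2⁻¹ : k) using 1
    have h2 : (2 : k) ≠ 0 := Ring.two_ne_zero hk
    funext w
    rw [Pi.smul_apply, Pi.add_apply, smul_eq_mul]
    by_cases hA : ∃ σ ∈ alternatingGroup (Fin n), w = σ ∘ z
    · rw [if_pos hA]
      obtain ⟨σ, hσ, rfl⟩ := hA
      rw [if_pos ⟨σ, rfl⟩, hF1, Equiv.Perm.mem_alternatingGroup.mp hσ]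
      norm_num [h2]
    · rw [if_neg hA]
      by_cases hS : ∃ σ : Equiv.Perm (Fin n), w = σ ∘ z
      · rw [if_pos hS]
        obtain ⟨σ, rfl⟩ := hS
        have hσ : Equiv.Perm.sign σ = -1 := (Int.units_eq_one_or _).resolve_left fun h =>
          hA ⟨σ, Equiv.Perm.mem_alternatingGroup.mpr h, rfl⟩
        rw [hF1, hσ]
        simp
      · rw [if_neg hS, hF0 w hS]
        simp
  -- No single additional entry makes `z` surjective, so beside any given `c` some other value is
  -- missed. Starting from an arbitrary value, available since `n > 0`, and applying this twice
  -- gives two distinct missed values.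
  · have hmiss : ∀ c, ∃ d, d ≠ c ∧ ∀ p, z p ≠ d := by
      intro c
      have h : ¬ Function.Surjective (Fin.append z ![c]) := fun h => hz ⟨c, h⟩
      rw [Function.Surjective, not_forall] at h
      obtain ⟨d, hd⟩ := h
      refine ⟨d, ?_, fun p hp => hd ⟨Fin.castAdd 1 p, by simpa using hp⟩⟩
      rintro rfl
      exact hd ⟨Fin.natAdd m 0, by simp⟩
    obtain ⟨c, -, hc⟩ := hmiss ⟨0, hn⟩
    obtain ⟨d, hdc, hd⟩ := hmiss c
    convert perm_orbit_mem_realizedFun z using 1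
    funext w
    refine if_congr ⟨fun ⟨σ, _, h⟩ => ⟨σ, h⟩, ?_⟩ rfl rfl
    rintro ⟨σ, rfl⟩
    rcases Int.units_eq_one_or (Equiv.Perm.sign σ) with h | h
    · exact ⟨σ, Equiv.Perm.mem_alternatingGroup.mpr h, rfl⟩
    -- The transposition of the two missed values fixes `z`, so it changes the parity of `σ` without
    -- changing `σ ∘ z`.
    · refine ⟨σ * Equiv.swap c d, ?_, funext fun p => ?_⟩
      · rw [Equiv.Perm.mem_alternatingGroup, Equiv.Perm.sign_mul, h,
          Equiv.Perm.sign_swap hdc.symm]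
        rfl
      · simp [Equiv.swap_apply_of_ne_of_ne (hc p) (hd p)]

/-- An invariant function is the sum over the `A_n`-orbits of its value at a representative times
the indicator of the orbit. -/
theorem mem_realizedFun_of_invariant (hk : ringChar k ≠ 2) (hn : 0 < n) {m : ℕ}
    {F : (Fin m → Fin n) → k}
    (hF : ∀ σ ∈ alternatingGroup (Fin n), ∀ w, F (σ ∘ w) = F w) : F ∈ realizedFun k n m := by
  classical
  let r : Setoid (Fin m → Fin n) :=
    { r := fun z w => ∃ σ ∈ alternatingGroup (Fin n), w = σ ∘ z
      iseqv := ⟨fun z => ⟨1, one_mem _, rfl⟩,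
        by
          rintro z _ ⟨σ, hσ, rfl⟩
          exact ⟨σ⁻¹, inv_mem hσ, by funext; simp⟩,
        by
          rintro z _ _ ⟨σ, hσ, rfl⟩ ⟨τ, hτ, rfl⟩
          exact ⟨τ * σ, mul_mem hτ hσ, rfl⟩⟩ }
  have h := (realizedFun k n m).sum_mem (t := Finset.univ) fun (q : Quotient r) _ =>
    (realizedFun k n m).smul_mem (alternating_orbit_mem_realizedFun hk hn q.out) (F q.out)
  convert h using 1
  funext w
  rw [Finset.sum_apply, Finset.sum_eq_single ⟦w⟧]
  · have hw : ∃ σ ∈ alternatingGroup (Fin n), w = σ ∘ (⟦w⟧ : Quotient r).out :=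
      Quotient.mk_out w
    rw [Pi.smul_apply, if_pos hw, smul_eq_mul, mul_one]
    obtain ⟨σ, hσ, h⟩ := hw
    exact (congrArg F h).trans (hF σ hσ _)
  · intro q _ hq
    rw [Pi.smul_apply, if_neg, smul_zero]
    intro h
    exact hq ((Quotient.out_eq q).symm.trans (Quotient.sound h))
  · simp

/-- Since `S_n` permutes the basis vectors, equivariance makes the matrix entries invariant under
applying `σ` to the input and output indices at once. -/
theorem isRealized_of_equivariant (hk : ringChar k ≠ 2) (hn : 0 < n) {a b : ℕ}
    (f : TP k n a →ₗ[k] TP k n b)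
    (hf : ∀ σ ∈ alternatingGroup (Fin n), f ∘ₗ tensorRep k n a σ = tensorRep k n b σ ∘ₗ f) :
    IsRealized f := by
  refine isRealized_of_matrix_mem f (mem_realizedFun_of_invariant hk hn fun σ hσ w => ?_)
  have h := LinearMap.congr_fun (hf σ hσ) (vec (w ∘ Fin.castAdd b))
  rw [LinearMap.comp_apply, LinearMap.comp_apply, tensorRep_vec] at h
  change (vecBasis k n b).repr (f (vec (σ ∘ (w ∘ Fin.castAdd b)))) (σ ∘ (w ∘ Fin.natAdd a)) = _
  rw [h]
  generalize f (vec (w ∘ Fin.castAdd b)) = v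
  -- The coordinate of `σ · v` at `σ ∘ y` is the coordinate of `v` at `y`; it is enough to check
  -- this on basis vectors.
  have hv : (Finsupp.lapply (σ ∘ (w ∘ Fin.natAdd a)) ∘ₗ (vecBasis k n b).repr.toLinearMap) ∘ₗ
      tensorRep k n b σ =
        Finsupp.lapply (w ∘ Fin.natAdd a) ∘ₗ (vecBasis k n b).repr.toLinearMap := by
    refine ext_vec fun y => ?_
    rw [LinearMap.comp_apply, tensorRep_vec]
    simp only [LinearMap.comp_apply, LinearEquiv.coe_coe, Finsupp.lapply_apply,
      ← vecBasis_apply, Module.Basis.repr_self, Finsupp.single_apply,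
      σ.injective.comp_left.eq_iff]
  exact LinearMap.congr_fun hv v

end Invariants

/-! ### Spanning by jellyfish diagrams, and values on pure tensors -/

section Diagrams

variable {k : Type u} [Field k] {n : ℕ}

open JP in
/-- Every morphism of `JP(n)` is a linear combination of jellyfish diagrams. -/
theorem ofTerm_mem_span {a b : ℕ} (t : Term k n a b) :
    (ofTerm t : (⟨a⟩ : JP k n) ⟶ ⟨b⟩) ∈ Submodule.span k {d | IsJellyfishDiagram d} := by
  induction t with
  | one a => exact Submodule.subset_span (.id _)
  | @comp a b c f g ihf ihg =>
    -- Composition is bilinear, so it carries a pair of spans into the span of the composites of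
    -- diagrams. The tensor product is treated in the same way below.
    have h := Submodule.apply_mem_map₂
      (Linear.comp (⟨a⟩ : JP k n) ⟨b⟩ ⟨c⟩ : _ →ₗ[k] _ →ₗ[k] _) ihf ihg
    rw [Submodule.map₂_span_span] at h
    refine Submodule.span_mono ?_ h
    rintro _ ⟨f, hf, g, hg, rfl⟩
    exact hf.comp hg
  | @tens a b c d f g ihf ihg =>
    let T : ((⟨a⟩ : JP k n) ⟶ ⟨b⟩) →ₗ[k] ((⟨c⟩ : JP k n) ⟶ ⟨d⟩) →ₗ[k]
        ((⟨a⟩ ⊗ ⟨c⟩ : JP k n) ⟶ ⟨b⟩ ⊗ ⟨d⟩) :=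
      LinearMap.mk₂ k (fun f g => f ⊗ₘ g) (fun _ _ _ => MonoidalPreadditive.add_tensor _ _ _)
        (fun r f g => by
          obtain ⟨f, rfl⟩ := ofTerm_surjective f
          obtain ⟨g, rfl⟩ := ofTerm_surjective g
          exact homMk_eq (Rel.smul_tensor _ _ _))
        (fun _ _ _ => MonoidalPreadditive.tensor_add _ _ _)
        (fun r f g => by
          obtain ⟨f, rfl⟩ := ofTerm_surjective f
          obtain ⟨g, rfl⟩ := ofTerm_surjective g
          exact homMk_eq (Rel.tensor_smul _ _ _))
    have h := Submodule.apply_mem_map₂ T ihf ihg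
    rw [Submodule.map₂_span_span] at h
    refine Submodule.span_mono ?_ h
    rintro _ ⟨f, hf, g, hg, rfl⟩
    exact hf.tensor hg
  | zero a b => exact zero_mem _
  | add f g ihf ihg => exact add_mem ihf ihg
  | smul r f ih => exact Submodule.smul_mem _ r ih
  | mu => exact Submodule.subset_span .mu
  | eta => exact Submodule.subset_span .eta
  | delta => exact Submodule.subset_span .delta
  | eps => exact Submodule.subset_span .eps
  | swap => exact Submodule.subset_span .swap
  | jelly => exact Submodule.subset_span .jelly

/-- `swapMap` is prescribed only on basis tensors; there it agrees with the reindexing along the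
transposition of the two factors, whose value on any pure tensor is known. -/
theorem swapMap_tprod (v w : Fin n → k) :
    swapMap (PiTensorProduct.tprod k ![v, w] : TP k n 2) = PiTensorProduct.tprod k ![w, v] := by
  have h : (swapMap : TP k n 2 →ₗ[k] TP k n 2) =
      (PiTensorProduct.reindex k (fun _ => Fin n → k) (Equiv.swap (0 : Fin 2) 1)).toLinearMap := by
    refine ext2_vec fun x y => ?_
    rw [swapMap_vec, LinearEquiv.coe_coe]
    refine Eq.trans ?_ (PiTensorProduct.reindex_tprod (R := k) (s := fun _ => Fin n → k)
      (Equiv.swap (0 : Fin 2) 1) fun r => Pi.single (![x, y] r) 1).symm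
    rw [vec]
    congr 1
    funext r; fin_cases r <;> simp
  rw [h, LinearEquiv.coe_coe, PiTensorProduct.reindex_tprod]
  congr 1
  funext r; fin_cases r <;> simp

/-- The determinant is multilinear, so it induces a linear functional on `V^{⊗n}`, which agrees with
`detMap` on basis tensors. The transpose passes from columns to the rows used by
`Matrix.detRowAlternating`. -/
theorem detMap_tprod (v : Fin n → Fin n → k) :
    detMap (PiTensorProduct.tprod k v : TP k n n) =
      Matrix.det (Matrix.of fun r c => v c r) • vec ![] := by
  have h : (detMap : TP k n n →ₗ[k] TP k n 0) = (LinearMap.toSpanSingleton k _ (vec ![])) ∘ₗ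
      PiTensorProduct.lift (Matrix.detRowAlternating (R := k) (n := Fin n)).toMultilinearMap := by
    refine ext_vec fun x => ?_
    rw [detMap_vec, LinearMap.comp_apply]
    refine Eq.trans ?_ (congrArg _ (PiTensorProduct.lift.tprod _).symm)
    rw [← Matrix.det_transpose]
    rfl
  rw [h, LinearMap.comp_apply, PiTensorProduct.lift.tprod, ← Matrix.det_transpose]
  rfl

end Diagrams
end Jellyfish

end

theorem theoremA {k : Type u} [Field k] (hk : ringChar k ≠ 2) (n : ℕ) (hn : 0 < n) :
    -- `Ψ` is full
    (Jellyfish.Psi k n).Full ∧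
    -- the monoidal structure of `Ψ` is the usual product of tensors
    (Functor.LaxMonoidal.ε (Jellyfish.Psi k n)).hom (1 : k) =
      (Jellyfish.vec ![] : Jellyfish.TP k n 0) ∧
    (∀ (a b : ℕ) (v : Fin a → Fin n → k) (w : Fin b → Fin n → k),
      (Functor.LaxMonoidal.μ (Jellyfish.Psi k n) ⟨a⟩ ⟨b⟩).hom
          (PiTensorProduct.tprod k v ⊗ₜ[k] PiTensorProduct.tprod k w) =
        (PiTensorProduct.tprod k (Fin.append v w) : Jellyfish.TP k n (a + b))) ∧
    -- the values of `Ψ` on the partition generators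
    (∀ x y : Fin n, Jellyfish.PsiMap Jellyfish.JP.mu (Jellyfish.vec ![x, y] : Jellyfish.TP k n 2) =
      if x = y then Jellyfish.vec ![x] else 0) ∧
    Jellyfish.PsiMap Jellyfish.JP.eta (Jellyfish.vec ![] : Jellyfish.TP k n 0) =
      ∑ x : Fin n, Jellyfish.vec ![x] ∧
    (∀ x : Fin n, Jellyfish.PsiMap Jellyfish.JP.delta (Jellyfish.vec ![x] : Jellyfish.TP k n 1) =
      Jellyfish.vec ![x, x]) ∧
    (∀ x : Fin n, Jellyfish.PsiMap Jellyfish.JP.eps (Jellyfish.vec ![x] : Jellyfish.TP k n 1) =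
      Jellyfish.vec ![]) ∧
    (∀ v w : Fin n → k, Jellyfish.PsiMap Jellyfish.JP.swap
        (PiTensorProduct.tprod k ![v, w] : Jellyfish.TP k n 2) =
      PiTensorProduct.tprod k ![w, v]) ∧
    -- `Ψ` sends the jellyfish to the determinant
    (∀ v : Fin n → Fin n → k, Jellyfish.PsiMap Jellyfish.JP.jelly
        (PiTensorProduct.tprod k v : Jellyfish.TP k n n) =
      Matrix.det (Matrix.of fun r c => v c r) • Jellyfish.vec ![]) ∧
    -- every `A_n`-equivariant map is the image of a linear combination of jellyfish diagrams
    (∀ (a b : ℕ) (f : Jellyfish.TP k n a →ₗ[k] Jellyfish.TP k n b),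
      (∀ σ ∈ alternatingGroup (Fin n),
        f ∘ₗ Jellyfish.tensorRep k n a σ = Jellyfish.tensorRep k n b σ ∘ₗ f) →
      ∃ d : (⟨a⟩ : Jellyfish.JP k n) ⟶ ⟨b⟩,
        d ∈ Submodule.span k {d | Jellyfish.JP.IsJellyfishDiagram d} ∧
          Jellyfish.PsiMap d = f) := by
  -- This is the last clause, and fullness follows from it: a formal expression that evaluates to
  -- `f` defines a morphism of `JP(n)`, which lies in the span of the diagrams.
  have surj : ∀ (a b : ℕ) (f : Jellyfish.TP k n a →ₗ[k] Jellyfish.TP k n b),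
      (∀ σ ∈ alternatingGroup (Fin n),
        f ∘ₗ Jellyfish.tensorRep k n a σ = Jellyfish.tensorRep k n b σ ∘ₗ f) →
      ∃ d : (⟨a⟩ : Jellyfish.JP k n) ⟶ ⟨b⟩,
        d ∈ Submodule.span k {d | Jellyfish.JP.IsJellyfishDiagram d} ∧
          Jellyfish.PsiMap d = f := by
    intro a b f hf
    obtain ⟨t, rfl⟩ := Jellyfish.isRealized_of_equivariant hk hn f hf
    exact ⟨Jellyfish.JP.ofTerm t, Jellyfish.ofTerm_mem_span t, rfl⟩
  refine ⟨⟨fun {X Y} g => ?_⟩, Jellyfish.isEmptyEquiv_symm_one, fun a b v w =>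
    Jellyfish.tmul_tprod v w, Jellyfish.muMap_vec, Jellyfish.etaMap_vec, Jellyfish.deltaMap_vec,
    Jellyfish.epsMap_vec, Jellyfish.swapMap_tprod, Jellyfish.detMap_tprod, surj⟩
  -- A morphism in `Rep` carries its equivariance for elements of the subgroup `alternatingGroup
  -- (Fin n)`.
  obtain ⟨d, -, hd⟩ := surj X.strands Y.strands g.hom.toLinearMap fun σ hσ =>
    g.hom.isIntertwining' ⟨σ, hσ⟩
  exact ⟨d, Rep.hom_ext (Representation.IntertwiningMap.ext hd)⟩
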